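/- Let $N\ge 1$, let $B(y,1)$ denote the open unit ball of $\mathbb{R}^N$ centred at $y$, and let $L^1_{\rm ul}(\mathbb{R}^N)$ be the space of measurable functions $\phi$ on $\mathbb{R}^N$ with $\|\phi\|_{L^1_{\rm ul}}:=\sup_{y\in\mathbb{R}^N}\int_{B(y,1)}|\phi|\,dx<\infty$; let $\mathcal{L}^1_{\rm ul}(\mathbb{R}^N)$ be the closure in $L^1_{\rm ul}(\mathbb{R}^N)$ of the bounded uniformly continuous functions. For $q\in[1,\infty)$ let $S_q$ be the set of all $f\in C([0,\infty))\cap C^1((0,\infty))$ such that $f(u)>0$, $f'(u)\ge 0$ and $F(u):=\int_u^\infty \frac{d\tau}{f(\tau)}<\infty$ for all $u>0$, and $\lim_{\xi\to\infty}f'(\xi)F(\xi)=q$. We allow $F(0)=\infty$, and set $\infty^{-r}=0$ for $r>0$. For $0<\gamma<\min\{2,N\}$, $T>0$ and $u_0\ge 0$, a nonnegative measurable function $u$ on $\mathbb{R}^N\times(0,T)$ is called a local-in-time solution in $\mathbb{R}^N\times(0,T)$ of $$\partial_t u-\Delta u=|x|^{-\gamma}f(u),\qquad u(x,0)=u_0(x),$$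 if $u\in L^\infty((0,T),L^1_{\rm ul}(\mathbb{R}^N))\cap L^\infty_{\rm loc}((0,T),L^\infty(\mathbb{R}^N))$ and, for every $0<t<T$ and a.e. $x\in\mathbb{R}^N$, $$u(x,t)=[e^{t\Delta}u_0](x)+\int_0^t\big[e^{(t-s)\Delta}\,|\cdot|^{-\gamma}f(u(\cdot,s))\big](x)\,ds,$$ where $[e^{t\Delta}\phi](x)=\int_{\mathbb{R}^N}(4\pi t)^{-N/2}e^{-|x-y|^2/(4t)}\phi(y)\,dy$. **Theorem.** Let $N\ge1$, $q\in[1,\infty)$, $f\in S_q$, $r\in\mathbb{R}$, and let $u_0\ge0$ be a function on $\mathbb{R}^N$. There is a constant $C>0$, depending only on $N$, $u_0$, $f$ and $r$, such that the following holds for every $\gamma$ with $0<\gamma<\min\{2,N\}$. If one of (i) $r>\frac{N}{2-\gamma}$, $q<1+r$ and $F(u_0)^{-r}\in L^1_{\rm ul}(\mathbb{R}^N)$; (ii) $r>\frac{N}{2-\gamma}$, $q=1+r$, $F(u_0)^{-r}\in L^1_{\rm ul}(\mathbb{R}^N)$, and $f'(\xi)F(\xi)\le q$ for all sufficiently large $\xi$;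 (iii) $r=\frac{N}{2-\gamma}$, $q<1+r$ and $F(u_0)^{-r}\in\mathcal{L}^1_{\rm ul}(\mathbb{R}^N)$ holds, then there exist $T>0$ and a nonnegative local-in-time solution $u$ in $\mathbb{R}^N\times(0,T)$, and this $u$ satisfies $$\|F(u(t))^{-r}\|_{L^1_{\rm ul}(\mathbb{R}^N)}\le C\qquad\text{for all }0<t<T.$$ -/

import Mathlib

open MeasureTheory Set Filter Topology
open scoped ENNReal NNReal

namespace HardyParabolic

noncomputable section

/-- `F(u) = ∫_u^∞ dτ / f(τ)`, with values in `[0, ∞]`. It may be `∞` at `u = 0`. -/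
def tailIntegral (f : ℝ → ℝ) (u : ℝ) : ℝ≥0∞ :=
  ∫⁻ τ in Ioi u, (ENNReal.ofReal (f τ))⁻¹

/-- `F(u)^{-r}`, with the convention `∞^{-r} = 0` for `r > 0`. For `f` as in `ClassS` and
`u ≥ 0` one has `F(u) > 0`, so that the power is finite and `toReal` loses nothing. -/
def negPowF (f : ℝ → ℝ) (r : ℝ) (u : ℝ) : ℝ :=
  ((tailIntegral f u) ^ (-r)).toReal

/-- The product `f'(ξ) F(ξ)`, used for `ξ > 0` only, where `F(ξ) < ∞`. -/
def derivMulF (f : ℝ → ℝ) (ξ : ℝ) : ℝ :=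
  deriv f ξ * (tailIntegral f ξ).toReal

/-- The class `S_q` of nonlinearities on `[0, ∞)`; the values of `f` at negative arguments
play no role. -/
structure ClassS (q : ℝ) (f : ℝ → ℝ) : Prop where
  continuousOn : ContinuousOn f (Ici 0)
  contDiffOn : ContDiffOn ℝ 1 f (Ioi 0)
  pos : ∀ u, 0 < u → 0 < f u
  deriv_nonneg : ∀ u, 0 < u → 0 ≤ deriv f u
  tail_lt_top : ∀ u, 0 < u → tailIntegral f u < ∞
  tendsto : Tendsto (derivMulF f) atTop (𝓝 q)

/-- The uniformly local `L¹` norm `sup_y ∫_{B(y,1)} |φ|`, with values in `[0, ∞]`. -/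
def ulNorm {N : ℕ} (φ : EuclideanSpace ℝ (Fin N) → ℝ) : ℝ≥0∞ :=
  ⨆ y : EuclideanSpace ℝ (Fin N), ∫⁻ x in Metric.ball y 1, ‖φ x‖ₑ

/-- Membership in the uniformly local space `L¹_ul(ℝ^N)`. -/
def MemUL {N : ℕ} (φ : EuclideanSpace ℝ (Fin N) → ℝ) : Prop :=
  AEStronglyMeasurable φ volume ∧ ulNorm φ < ∞

/-- Membership in the closure of the bounded uniformly continuous functions in
`L¹_ul(ℝ^N)`. -/
def MemULClosure {N : ℕ} (φ : EuclideanSpace ℝ (Fin N) → ℝ) : Prop :=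
  MemUL φ ∧ ∀ ε : ℝ≥0∞, 0 < ε →
    ∃ g : EuclideanSpace ℝ (Fin N) → ℝ,
      UniformContinuous g ∧ (∃ M : ℝ, ∀ x, |g x| ≤ M) ∧ ulNorm (fun x => φ x - g x) < ε

/-- The heat kernel `G(z, t) = (4πt)^{-N/2} exp(-|z|² / (4t))`. -/
def heatKernel {N : ℕ} (t : ℝ) (z : EuclideanSpace ℝ (Fin N)) : ℝ :=
  (4 * Real.pi * t) ^ (-(N : ℝ) / 2) * Real.exp (-‖z‖ ^ 2 / (4 * t))

/-- `[e^{tΔ} φ](x) = ∫ G(x - y, t) φ(y) dy` for nonnegative `φ`, with values in `[0, ∞]`. -/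
def heatEvol {N : ℕ} (t : ℝ) (φ : EuclideanSpace ℝ (Fin N) → ℝ)
    (x : EuclideanSpace ℝ (Fin N)) : ℝ≥0∞ :=
  ∫⁻ y, ENNReal.ofReal (heatKernel t (x - y)) * ENNReal.ofReal (φ y)

/-- `u` (time first, then space) is a nonnegative local-in-time solution on `ℝ^N × (0, T)` of
`∂_t u - Δu = |x|^{-γ} f(u)`, `u(·, 0) = u₀`: it is a nonnegative measurable function in
`L^∞((0,T), L¹_ul) ∩ L^∞_loc((0,T), L^∞)` satisfying Duhamel's formula. As all integrands are
nonnegative, the formula is an identity in `[0, ∞]`; it says in particular that both terms on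
its right-hand side are finite. -/
structure IsLocalSolution {N : ℕ} (γ : ℝ) (f : ℝ → ℝ) (u₀ : EuclideanSpace ℝ (Fin N) → ℝ)
    (T : ℝ) (u : ℝ → EuclideanSpace ℝ (Fin N) → ℝ) : Prop where
  measurable : AEMeasurable (Function.uncurry u)
    ((volume : Measure (ℝ × EuclideanSpace ℝ (Fin N))).restrict (Ioo 0 T ×ˢ univ))
  nonneg : ∀ t ∈ Ioo 0 T, ∀ x, 0 ≤ u t x
  bounded_ul : ∃ M : ℝ≥0, ∀ᵐ t ∂(volume.restrict (Ioo 0 T)), MemUL (u t) ∧ ulNorm (u t) ≤ M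
  locally_bounded : ∀ a b : ℝ, 0 < a → b < T →
    ∃ M : ℝ≥0, ∀ᵐ t ∂(volume.restrict (Icc a b)), eLpNorm (u t) ∞ volume ≤ M
  duhamel : ∀ t ∈ Ioo 0 T, ∀ᵐ x,
    ENNReal.ofReal (u t x) = heatEvol t u₀ x +
      ∫⁻ s in Ioo 0 t, heatEvol (t - s) (fun y => ‖y‖ ^ (-γ) * f (u s y)) x

end

end HardyParabolic

/-!
Write `G = F^{-r}`. The condition `f' F ≤ 1 + r` says that `G` is convex, so Jensen's inequality
for the heat semigroup gives `e^{tΔ} u₀ ≤ G⁻¹(e^{tΔ} G(u₀))`: the linear evolution is controlled by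
`h = G(ξ) + G(u₀) ∈ L¹_ul`, the shift by `G(ξ)` making up for the failure of convexity below `ξ`.
The barrier `w = G⁻¹(2 e^{tΔ} h)` is a supersolution of Duhamel's formula for small times. Indeed
`G(w)` exceeds `e^{tΔ} h` by a factor `2`, so by convexity `w` exceeds `e^{tΔ} u₀` by a fixed
multiple of `f(w) F(w)`, while the Duhamel term of `w` is bounded by `f(w) F(w)` times
`E^{1/r} t^{1 - γ/2 - N/(2r)}`, where `e^{tΔ} h ≤ E t^{-N/2}`. To see the latter, compare
`f(w(s, y))` with `f(w(t, x)) F(w(t, x))`, which costs a power of `e^{sΔ} h` and a linear factor;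
the linear factor is reproduced by the semigroup even in presence of the weight `|x|^{-γ}`. Indeed,
for the heat kernel `Γ`, the product `Γ(x - y, t - s) Γ(y - z, s)` is `Γ(x - z, t)` times a heat
kernel in `y` (a Brownian bridge) at time `s (t - s) / t`, which integrates the weight to at most a
multiple of `(s (t - s) / t)^{-γ/2}`. For `r > N / (2 - γ)` the power of `t` makes this small; for
`r = N / (2 - γ)` it is `t^0`, but `E` can be chosen small when `G(u₀)` is close to a bounded
function in `L¹_ul`. Monotone iteration below `w` then gives the solution.
-/

namespace HardyParabolic

section Nonlinearity

variable {q r p ξ : ℝ} {f : ℝ → ℝ}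

lemma tailIntegral_antitone (f : ℝ → ℝ) : Antitone (tailIntegral f) := fun _ _ h =>
  lintegral_mono_set (Ioi_subset_Ioi h)

lemma measurable_negPowF (f : ℝ → ℝ) (r : ℝ) : Measurable (negPowF f r) :=
  ((tailIntegral_antitone f).measurable.pow_const _).ennreal_toReal

lemma negPowF_nonneg (f : ℝ → ℝ) (r u : ℝ) : 0 ≤ negPowF f r u := ENNReal.toReal_nonneg

/-- The tail integral `F` as a real-valued function. It has the junk value `0` where
`F = ∞`, which for `f` in the class `S_q` and `u ≥ 0` happens at most at `u = 0`. -/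
noncomputable def tailReal (f : ℝ → ℝ) (u : ℝ) : ℝ := (tailIntegral f u).toReal

lemma negPowF_eq_tailReal_rpow (f : ℝ → ℝ) (r u : ℝ) : negPowF f r u = tailReal f u ^ (-r) :=
  (ENNReal.toReal_rpow _ _).symm

namespace ClassS

lemma monotoneOn (hf : ClassS q f) : MonotoneOn f (Ici 0) := by
  refine monotoneOn_of_deriv_nonneg (convex_Ici 0) hf.continuousOn ?_ ?_
  · rw [interior_Ici]
    exact hf.contDiffOn.differentiableOn (by norm_num)
  · rw [interior_Ici]
    exact fun u hu => hf.deriv_nonneg u hu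

lemma hasDerivAt (hf : ClassS q f) {u : ℝ} (hu : 0 < u) : HasDerivAt f (deriv f u) u :=
  ((hf.contDiffOn.differentiableOn (by norm_num)).differentiableAt (Ioi_mem_nhds hu)).hasDerivAt

lemma tailIntegral_lt (hf : ClassS q f) {u v : ℝ} (hu : 0 ≤ u) (huv : u < v) :
    tailIntegral f v < tailIntegral f u := by
  have hv : 0 < v := hu.trans_lt huv
  have split : tailIntegral f u =
      tailIntegral f v + ∫⁻ τ in Ioc u v, (ENNReal.ofReal (f τ))⁻¹ := by
    rw [tailIntegral, ← Ioc_union_Ioi_eq_Ioi huv.le,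
      lintegral_union measurableSet_Ioi (Ioc_disjoint_Ioi le_rfl), add_comm]
    rfl
  have lower : (ENNReal.ofReal (f v))⁻¹ * ENNReal.ofReal (v - u) ≤
      ∫⁻ τ in Ioc u v, (ENNReal.ofReal (f τ))⁻¹ := by
    rw [← Real.volume_Ioc, ← setLIntegral_const]
    exact setLIntegral_mono' measurableSet_Ioc fun τ hτ => ENNReal.inv_le_inv.2
      (ENNReal.ofReal_le_ofReal (hf.monotoneOn (hu.trans hτ.1.le) hv.le hτ.2))
  have lower_pos : 0 < (ENNReal.ofReal (f v))⁻¹ * ENNReal.ofReal (v - u) :=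
    ENNReal.mul_pos (ENNReal.inv_ne_zero.2 ENNReal.ofReal_ne_top)
      (ENNReal.ofReal_pos.2 (sub_pos.2 huv)).ne'
  rw [split]
  exact ENNReal.lt_add_right (hf.tail_lt_top v hv).ne (lower_pos.trans_le lower).ne'

lemma tailReal_pos (hf : ClassS q f) {u : ℝ} (hu : 0 < u) : 0 < tailReal f u :=
  ENNReal.toReal_pos (bot_le.trans_lt (hf.tailIntegral_lt hu.le (lt_add_one u))).ne'
    (hf.tail_lt_top u hu).ne

lemma continuousOn_inv (hf : ClassS q f) : ContinuousOn (fun u => (f u)⁻¹) (Ioi 0) :=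
  (hf.continuousOn.mono Ioi_subset_Ici_self).inv₀ fun u hu => (hf.pos u hu).ne'

lemma integrableOn_inv (hf : ClassS q f) {u : ℝ} (hu : 0 < u) :
    IntegrableOn (fun u => (f u)⁻¹) (Ioi u) := by
  refine ⟨(hf.continuousOn_inv.mono (Ioi_subset_Ioi hu.le)).aestronglyMeasurable
    measurableSet_Ioi, ?_⟩
  refine lt_of_eq_of_lt (setLIntegral_congr_fun measurableSet_Ioi fun τ hτ => ?_)
    (hf.tail_lt_top u hu)
  have hfτ := hf.pos τ (hu.trans hτ)
  rw [Real.enorm_of_nonneg (by positivity), ENNReal.ofReal_inv_of_pos hfτ]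

lemma tailReal_eq_integral (hf : ClassS q f) {u : ℝ} (hu : 0 < u) :
    tailReal f u = ∫ τ in Ioi u, (f τ)⁻¹ := by
  rw [integral_eq_lintegral_of_nonneg_ae, tailReal, tailIntegral]
  · congr 1
    refine setLIntegral_congr_fun measurableSet_Ioi fun τ hτ => ?_
    rw [ENNReal.ofReal_inv_of_pos (hf.pos τ (hu.trans hτ))]
  · refine (ae_restrict_iff' measurableSet_Ioi).2 (ae_of_all _ fun τ hτ => ?_)
    exact inv_nonneg.2 (hf.pos τ (hu.trans hτ)).le
  · exact (hf.integrableOn_inv hu).1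

lemma hasDerivAt_tailReal (hf : ClassS q f) {u : ℝ} (hu : 0 < u) :
    HasDerivAt (tailReal f) (-(f u)⁻¹) u := by
  have hu2 : 0 < u / 2 := by positivity
  have hderiv : HasDerivAt
      (fun v => (∫ τ in Ioi (u / 2), (f τ)⁻¹) - ∫ τ in (u / 2)..v, (f τ)⁻¹) (-(f u)⁻¹) u := by
    refine (intervalIntegral.integral_hasDerivAt_right ?_ ?_ ?_).const_sub _
    · refine ContinuousOn.intervalIntegrable (hf.continuousOn_inv.mono ?_)
      rw [uIcc_of_le (by linarith)]
      exact fun x hx => hu2.trans_le hx.1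
    · exact hf.continuousOn_inv.stronglyMeasurableAtFilter isOpen_Ioi _ hu
    · exact hf.continuousOn_inv.continuousAt (Ioi_mem_nhds hu)
  refine hderiv.congr_of_eventuallyEq ?_
  filter_upwards [Ioi_mem_nhds (show u / 2 < u by linarith)] with v hv
  have hv : u / 2 < v := hv
  rw [hf.tailReal_eq_integral (hu2.trans hv), intervalIntegral.integral_of_le hv.le,
    eq_sub_iff_add_eq', ← setIntegral_union (by simp) measurableSet_Ioi
      ((hf.integrableOn_inv hu2).mono_set Ioc_subset_Ioi_self) (hf.integrableOn_inv (hu2.trans hv)),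
    Ioc_union_Ioi_eq_Ioi hv.le]

lemma tendsto_tailReal (hf : ClassS q f) : Tendsto (tailReal f) atTop (𝓝[>] 0) := by
  refine tendsto_nhdsWithin_iff.2
    ⟨?_, (eventually_gt_atTop 0).mono fun u hu => hf.tailReal_pos hu⟩
  refine (tendsto_integral_Ioi_zero (f := fun τ => (f τ)⁻¹) (μ := volume) tendsto_id).congr' ?_
  filter_upwards [eventually_gt_atTop 0] with u hu
  exact (hf.tailReal_eq_integral hu).symm

lemma hasDerivAt_mul_rpow (hf : ClassS q f) {u : ℝ} (hu : 0 < u) (p : ℝ) :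
    HasDerivAt (fun v => f v * tailReal f v ^ p)
      (tailReal f u ^ (p - 1) * (derivMulF f u - p)) u := by
  have hF := hf.tailReal_pos hu
  have hfu := hf.pos u hu
  convert! (hf.hasDerivAt hu).fun_mul
    ((hf.hasDerivAt_tailReal hu).rpow_const (p := p) (Or.inl hF.ne')) using 1
  have hpow : tailReal f u ^ p = tailReal f u ^ (p - 1) * tailReal f u := by
    rw [← Real.rpow_add_one hF.ne']
    ring_nf
  rw [hpow, derivMulF, ← tailReal]
  field_simp
  ring

lemma monotoneOn_mul_rpow (hf : ClassS q f) (hξ : 0 < ξ)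
    (hp : ∀ u, ξ ≤ u → p ≤ derivMulF f u) :
    MonotoneOn (fun v => f v * tailReal f v ^ p) (Ici ξ) := by
  have hd (u : ℝ) (hu : u ∈ Ici ξ) := hf.hasDerivAt_mul_rpow (hξ.trans_le hu) p
  refine monotoneOn_of_deriv_nonneg (convex_Ici ξ)
    (fun u hu => (hd u hu).continuousAt.continuousWithinAt)
    (fun u hu => (hd u (interior_subset hu)).differentiableAt.differentiableWithinAt) ?_
  intro u hu
  have hu := interior_subset hu
  rw [(hd u hu).deriv]
  exact mul_nonneg (Real.rpow_nonneg (hf.tailReal_pos (hξ.trans_le hu)).le _)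
    (sub_nonneg.2 (hp u hu))

lemma antitoneOn_mul_rpow (hf : ClassS q f) (hξ : 0 < ξ)
    (hp : ∀ u, ξ ≤ u → derivMulF f u ≤ p) :
    AntitoneOn (fun v => f v * tailReal f v ^ p) (Ici ξ) := by
  have hd (u : ℝ) (hu : u ∈ Ici ξ) := hf.hasDerivAt_mul_rpow (hξ.trans_le hu) p
  refine antitoneOn_of_deriv_nonpos (convex_Ici ξ)
    (fun u hu => (hd u hu).continuousAt.continuousWithinAt)
    (fun u hu => (hd u (interior_subset hu)).differentiableAt.differentiableWithinAt) ?_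
  intro u hu
  have hu := interior_subset hu
  rw [(hd u hu).deriv]
  exact mul_nonpos_of_nonneg_of_nonpos
    (Real.rpow_nonneg (hf.tailReal_pos (hξ.trans_le hu)).le _) (sub_nonpos.2 (hp u hu))

lemma negPowF_pos (hf : ClassS q f) (r : ℝ) {u : ℝ} (hu : 0 < u) : 0 < negPowF f r u := by
  rw [negPowF_eq_tailReal_rpow]
  exact Real.rpow_pos_of_pos (hf.tailReal_pos hu) _

lemma hasDerivAt_negPowF (hf : ClassS q f) (r : ℝ) {u : ℝ} (hu : 0 < u) :
    HasDerivAt (negPowF f r) (r * negPowF f r u / (f u * tailReal f u)) u := by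
  have hF := hf.tailReal_pos hu
  convert! (hf.hasDerivAt_tailReal hu).rpow_const (p := -r) (Or.inl hF.ne') using 1
  · exact funext (negPowF_eq_tailReal_rpow f r)
  · have hfu := hf.pos u hu
    rw [negPowF_eq_tailReal_rpow, Real.rpow_sub_one hF.ne']
    field_simp

lemma negPowF_strictMonoOn (hf : ClassS q f) (hr : 0 < r) :
    StrictMonoOn (negPowF f r) (Ici 0) := by
  intro u hu v _ huv
  have hv : 0 < v := lt_of_le_of_lt hu huv
  have hFv := hf.tailReal_pos hv
  rw [negPowF_eq_tailReal_rpow, negPowF_eq_tailReal_rpow]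
  by_cases htop : tailIntegral f u = ∞
  · rw [tailReal, htop, ENNReal.toReal_top, Real.zero_rpow (by linarith)]
    positivity
  · exact Real.rpow_lt_rpow_of_neg hFv
      (ENNReal.toReal_strict_mono htop (hf.tailIntegral_lt hu huv)) (by linarith)

lemma tendsto_negPowF (hf : ClassS q f) (hr : 0 < r) : Tendsto (negPowF f r) atTop atTop :=
  ((tendsto_rpow_neg_nhdsGT_zero (neg_lt_zero.2 hr)).comp hf.tendsto_tailReal).congr
    fun u => (negPowF_eq_tailReal_rpow f r u).symm

lemma convexOn_negPowF (hf : ClassS q f) (hr : 0 ≤ r) (hξ : 0 < ξ)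
    (h : ∀ u, ξ ≤ u → derivMulF f u ≤ 1 + r) : ConvexOn ℝ (Ici ξ) (negPowF f r) := by
  have hd (u : ℝ) (hu : u ∈ Ici ξ) := hf.hasDerivAt_negPowF r (hξ.trans_le hu)
  have hderiv : ∀ u ∈ Ici ξ, deriv (negPowF f r) u = r * (f u * tailReal f u ^ (1 + r))⁻¹ := by
    intro u hu
    have hF := hf.tailReal_pos (hξ.trans_le hu)
    rw [(hd u hu).deriv, negPowF_eq_tailReal_rpow, Real.rpow_neg hF.le, Real.rpow_add hF,
      Real.rpow_one]
    field_simp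
  have hpos : ∀ u ∈ Ici ξ, 0 < f u * tailReal f u ^ (1 + r) := fun u hu =>
    mul_pos (hf.pos u (hξ.trans_le hu)) (Real.rpow_pos_of_pos (hf.tailReal_pos (hξ.trans_le hu)) _)
  refine MonotoneOn.convexOn_of_deriv (convex_Ici ξ)
    (fun u hu => (hd u hu).continuousAt.continuousWithinAt)
    (fun u hu => (hd u (interior_subset hu)).differentiableAt.differentiableWithinAt) ?_
  intro u hu v hv huv
  have hu := interior_subset hu
  have hv := interior_subset hv
  rw [hderiv u hu, hderiv v hv]
  exact mul_le_mul_of_nonneg_left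
    (inv_anti₀ (hpos v hv) (hf.antitoneOn_mul_rpow hξ h hu hv huv)) hr

end ClassS

/-- The generalised inverse of `F^{-r}` on the half-line. For `v` below the range of `F^{-r}`
it is `0`, the junk value of the supremum of the empty set. -/
noncomputable def negPowInv (f : ℝ → ℝ) (r v : ℝ) : ℝ := sSup {u | 0 ≤ u ∧ negPowF f r u ≤ v}

lemma negPowInv_nonneg (f : ℝ → ℝ) (r v : ℝ) : 0 ≤ negPowInv f r v :=
  Real.sSup_nonneg fun _ h => h.1

namespace ClassS

lemma negPowInv_negPowF (hf : ClassS q f) (hr : 0 < r) {u : ℝ} (hu : 0 ≤ u) :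
    negPowInv f r (negPowF f r u) = u := by
  have hsub : {w | 0 ≤ w ∧ negPowF f r w ≤ negPowF f r u} = Icc 0 u := by
    ext w
    exact and_congr_right fun hw => (hf.negPowF_strictMonoOn hr).le_iff_le hw hu
  rw [negPowInv, hsub, csSup_Icc hu]

lemma negPowInv_monotone (hf : ClassS q f) (hr : 0 < r) : Monotone (negPowInv f r) := by
  intro a b hab
  have hbdd : BddAbove {u | 0 ≤ u ∧ negPowF f r u ≤ b} := by
    obtain ⟨c, hc⟩ := ((hf.tendsto_negPowF hr).eventually_gt_atTop b).exists_forall_of_atTop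
    exact ⟨c, fun u hu => le_of_not_ge fun h => (hc u h).not_ge hu.2⟩
  rcases Set.eq_empty_or_nonempty {u | 0 ≤ u ∧ negPowF f r u ≤ a} with h | h
  · rw [negPowInv, h, Real.sSup_empty]
    exact negPowInv_nonneg f r b
  · exact csSup_le_csSup hbdd h fun u hu => ⟨hu.1, hu.2.trans hab⟩

lemma exists_negPowF_eq (hf : ClassS q f) (hr : 0 < r) (hξ : 0 < ξ) {v : ℝ}
    (hv : negPowF f r ξ ≤ v) : ∃ u, ξ ≤ u ∧ negPowF f r u = v := by
  obtain ⟨a, hva, hξa⟩ :=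
    (((hf.tendsto_negPowF hr).eventually_ge_atTop v).and (eventually_ge_atTop ξ)).exists
  have hcont : ContinuousOn (negPowF f r) (Icc ξ a) := fun u hu =>
    (hf.hasDerivAt_negPowF r (hξ.trans_le hu.1)).continuousAt.continuousWithinAt
  obtain ⟨u, hu, huv⟩ := intermediate_value_Icc hξa hcont ⟨hv, hva⟩
  exact ⟨u, hu.1, huv⟩

lemma negPowF_negPowInv (hf : ClassS q f) (hr : 0 < r) (hξ : 0 < ξ) {v : ℝ}
    (hv : negPowF f r ξ ≤ v) : negPowF f r (negPowInv f r v) = v := by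
  obtain ⟨u, hu, rfl⟩ := hf.exists_negPowF_eq hr hξ hv
  rw [hf.negPowInv_negPowF hr (hξ.le.trans hu)]

lemma le_negPowInv (hf : ClassS q f) (hr : 0 < r) (hξ : 0 < ξ) {v : ℝ}
    (hv : negPowF f r ξ ≤ v) : ξ ≤ negPowInv f r v := by
  simpa only [hf.negPowInv_negPowF hr hξ.le] using hf.negPowInv_monotone hr hv

end ClassS

lemma tangent_le_of_convexOn {S : Set ℝ} {g : ℝ → ℝ} {g' a b : ℝ} (hg : ConvexOn ℝ S g)
    (ha : a ∈ S) (hb : b ∈ S) (hd : HasDerivAt g g' a) : g a + g' * (b - a) ≤ g b := by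
  rcases lt_trichotomy a b with hab | rfl | hab
  · have h := hg.le_slope_of_hasDerivAt ha hb hab hd
    rw [slope_def_field, le_div_iff₀ (by linarith)] at h
    linarith
  · simp
  · have h := hg.slope_le_of_hasDerivAt hb ha hab hd
    rw [slope_def_field, div_le_iff₀ (by linarith)] at h
    linarith

namespace ClassS

lemma le_tangent_negPowF (hf : ClassS q f) (hr : 0 < r) (hξ : 0 < ξ)
    (hconv : ConvexOn ℝ (Ici ξ) (negPowF f r)) {a b : ℝ} (ha : ξ ≤ a) (hb : ξ ≤ b) :
    f a * tailReal f a / r + b ≤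
      a + f a * tailReal f a / (r * negPowF f r a) * negPowF f r b := by
  have ha0 := hξ.trans_le ha
  have hfa := hf.pos a ha0
  have hFa := hf.tailReal_pos ha0
  have hGa := hf.negPowF_pos r ha0
  have htan := mul_le_mul_of_nonneg_left
    (tangent_le_of_convexOn hconv ha hb (hf.hasDerivAt_negPowF r ha0))
    (show 0 ≤ f a * tailReal f a / (r * negPowF f r a) by positivity)
  have hexpand : f a * tailReal f a / (r * negPowF f r a) *
      (negPowF f r a + r * negPowF f r a / (f a * tailReal f a) * (b - a)) =
      f a * tailReal f a / r + (b - a) := by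
    field_simp
  linarith

lemma half_step_le_sub (hf : ClassS q f) (hr : 0 < r) (hξ : 0 < ξ)
    (hconv : ConvexOn ℝ (Ici ξ) (negPowF f r)) {a b : ℝ} (ha : ξ ≤ a) (hb : ξ ≤ b)
    (hab : negPowF f r b = 2 * negPowF f r a) : f b * tailReal f b / (2 * r) ≤ b - a := by
  have hGb := hf.negPowF_pos r (hξ.trans_le hb)
  have htan := hf.le_tangent_negPowF hr hξ hconv hb ha
  have hhalf : f b * tailReal f b / (r * negPowF f r b) * negPowF f r a =
      f b * tailReal f b / (2 * r) := by
    rw [show negPowF f r a = negPowF f r b / 2 by linarith]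
    field_simp
  have hdouble : f b * tailReal f b / r = 2 * (f b * tailReal f b / (2 * r)) := by field_simp
  linarith

end ClassS

/-- The bounds on `f' F` beyond `ξ` that the barrier argument needs:
`p ≤ f' F ≤ p + r` with an exponent `p ∈ [0, 1]`. -/
structure GrowthWindow (f : ℝ → ℝ) (r p ξ : ℝ) : Prop where
  pos : 0 < ξ
  exponent_nonneg : 0 ≤ p
  exponent_le_one : p ≤ 1
  le_derivMulF : ∀ u, ξ ≤ u → p ≤ derivMulF f u
  derivMulF_le : ∀ u, ξ ≤ u → derivMulF f u ≤ p + r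

lemma ClassS.exists_growthWindow_of_lt (hf : ClassS q f) (hq : 1 ≤ q) (hr : 0 < r)
    (hqr : q < 1 + r) : ∃ p ξ, p < 1 ∧ GrowthWindow f r p ξ := by
  -- `p = (q - r + 1) / 2` is the midpoint of `(q - r, 1)`, truncated at `0`.
  have hlim : ∀ᶠ u in atTop, max 0 ((q - r + 1) / 2) < derivMulF f u ∧
      derivMulF f u < max 0 ((q - r + 1) / 2) + r :=
    (hf.tendsto.eventually (lt_mem_nhds (max_lt (by linarith) (by linarith)))).and
      (hf.tendsto.eventually (gt_mem_nhds
        (by linarith [le_max_right 0 ((q - r + 1) / 2)])))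
  obtain ⟨ξ, hξ⟩ := (hlim.and (eventually_gt_atTop 0)).exists_forall_of_atTop
  exact ⟨_, ξ, max_lt one_pos (by linarith), (hξ ξ le_rfl).2, le_max_left _ _,
    max_le zero_le_one (by linarith), fun u hu => (hξ u hu).1.1.le, fun u hu => (hξ u hu).1.2.le⟩

lemma ClassS.exists_growthWindow_one (hf : ClassS q f) (hr : 0 < r) (hqr : q = 1 + r)
    (hle : ∀ᶠ u in atTop, derivMulF f u ≤ q) : ∃ ξ, GrowthWindow f r 1 ξ := by
  have hlim := hf.tendsto.eventually (lt_mem_nhds (show 1 < q by linarith))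
  obtain ⟨ξ, hξ⟩ := ((hlim.and hle).and (eventually_gt_atTop 0)).exists_forall_of_atTop
  exact ⟨ξ, (hξ ξ le_rfl).2, zero_le_one, le_rfl, fun u hu => (hξ u hu).1.1.le,
    fun u hu => (hξ u hu).1.2.trans hqr.le⟩

namespace GrowthWindow

lemma convexOn_negPowF (hw : GrowthWindow f r p ξ) (hf : ClassS q f) (hr : 0 ≤ r) :
    ConvexOn ℝ (Ici ξ) (negPowF f r) :=
  hf.convexOn_negPowF hr hw.pos fun u hu =>
    (hw.derivMulF_le u hu).trans (by linarith [hw.exponent_le_one])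

lemma apply_le_mul_div_rpow (hw : GrowthWindow f r p ξ) (hf : ClassS q f) {a b : ℝ}
    (ha : ξ ≤ a) (hb : ξ ≤ b) :
    f a ≤ f b * (tailReal f b / tailReal f a) ^ p * (1 + negPowF f r a / negPowF f r b) := by
  have ha0 := hw.pos.trans_le ha
  have hb0 := hw.pos.trans_le hb
  have hFa := hf.tailReal_pos ha0
  have hFb := hf.tailReal_pos hb0
  have hfb := hf.pos b hb0
  have hratio : 0 ≤ negPowF f r a / negPowF f r b :=
    div_nonneg (negPowF_nonneg _ _ _) (negPowF_nonneg _ _ _)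
  have hmain : 0 ≤ f b * (tailReal f b / tailReal f a) ^ p := by positivity
  rcases le_total a b with hab | hba
  · refine le_trans ?_ (le_mul_of_one_le_right hmain (le_add_of_nonneg_right hratio))
    rw [Real.div_rpow hFb.le hFa.le, ← mul_div_assoc, le_div_iff₀ (by positivity)]
    exact hf.monotoneOn_mul_rpow hw.pos hw.le_derivMulF ha hb hab
  · refine le_trans ?_ (mul_le_mul_of_nonneg_left (le_add_of_nonneg_left zero_le_one) hmain)
    have hG : negPowF f r a / negPowF f r b = (tailReal f b / tailReal f a) ^ r := by
      rw [negPowF_eq_tailReal_rpow, negPowF_eq_tailReal_rpow, ← Real.div_rpow hFa.le hFb.le,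
        Real.rpow_neg (by positivity), ← Real.inv_rpow (by positivity), inv_div]
    rw [hG, mul_assoc, ← Real.rpow_add (by positivity), Real.div_rpow hFb.le hFa.le,
      ← mul_div_assoc, le_div_iff₀ (by positivity)]
    exact hf.antitoneOn_mul_rpow hw.pos hw.derivMulF_le hb ha hba

lemma apply_le (hw : GrowthWindow f r p ξ) (hf : ClassS q f) (hr : 0 < r) {a b : ℝ}
    (ha : ξ ≤ a) (hb : ξ ≤ b) :
    f a ≤ f b * tailReal f b * (negPowF f r a ^ (p / r) * negPowF f r b ^ ((1 - p) / r)) *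
      (1 + negPowF f r a / negPowF f r b) := by
  have hFa := hf.tailReal_pos (hw.pos.trans_le ha)
  have hFb := hf.tailReal_pos (hw.pos.trans_le hb)
  have hGa : negPowF f r a ^ (p / r) = tailReal f a ^ (-p) := by
    rw [negPowF_eq_tailReal_rpow, ← Real.rpow_mul hFa.le]
    congr 1
    field_simp
  have hGb : tailReal f b * negPowF f r b ^ ((1 - p) / r) = tailReal f b ^ p := by
    rw [negPowF_eq_tailReal_rpow, ← Real.rpow_mul hFb.le]
    nth_rewrite 1 [← Real.rpow_one (tailReal f b)]
    rw [← Real.rpow_add hFb]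
    congr 1
    field_simp
    ring
  convert hw.apply_le_mul_div_rpow hf ha hb using 2
  rw [Real.div_rpow hFb.le hFa.le, hGa, ← hGb, Real.rpow_neg hFa.le]
  ring

end GrowthWindow

end Nonlinearity

section Heat

variable {N : ℕ} {s t : ℝ} {φ ψ : EuclideanSpace ℝ (Fin N) → ℝ≥0∞}

lemma heatKernel_nonneg (ht : 0 < t) (z : EuclideanSpace ℝ (Fin N)) : 0 ≤ heatKernel t z := by
  unfold heatKernel
  positivity

lemma lintegral_heatKernel (ht : 0 < t) :
    ∫⁻ z : EuclideanSpace ℝ (Fin N), ENNReal.ofReal (heatKernel t z) = 1 := by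
  have hb : 0 < 1 / (4 * t) := by positivity
  have hker : ∀ z : EuclideanSpace ℝ (Fin N), heatKernel t z =
      (4 * Real.pi * t) ^ (-(N : ℝ) / 2) * Real.exp (-(1 / (4 * t)) * ‖z‖ ^ 2) := by
    intro z
    rw [heatKernel]
    congr 2
    ring
  have hint : Integrable
      fun v : EuclideanSpace ℝ (Fin N) => Real.exp (-(1 / (4 * t)) * ‖v‖ ^ 2) := by
    refine not_imp_comm.1 integral_undef ?_
    rw [GaussianFourier.integral_rexp_neg_mul_sq_norm hb]
    positivity
  simp_rw [hker]
  rw [← ofReal_integral_eq_lintegral_ofReal (hint.const_mul _)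
    (ae_of_all _ fun z => by positivity), integral_const_mul,
    GaussianFourier.integral_rexp_neg_mul_sq_norm hb,
    show Real.pi / (1 / (4 * t)) = 4 * Real.pi * t by field_simp, finrank_euclideanSpace,
    Fintype.card_fin, ← Real.rpow_add (by positivity), neg_div, neg_add_cancel]
  simp

lemma lintegral_heatKernel_sub (ht : 0 < t) (x : EuclideanSpace ℝ (Fin N)) :
    ∫⁻ y, ENNReal.ofReal (heatKernel t (x - y)) = 1 := by
  rw [lintegral_sub_left_eq_self (fun z => ENNReal.ofReal (heatKernel t z)) x]
  exact lintegral_heatKernel ht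

lemma measurable_heatKernel_sub (t : ℝ) (x : EuclideanSpace ℝ (Fin N)) :
    Measurable fun y => ENNReal.ofReal (heatKernel t (x - y)) := by
  unfold heatKernel
  fun_prop

/-- The heat semigroup `e^{tΔ}` acting on `[0, ∞]`-valued functions. -/
noncomputable def heatOp (t : ℝ) (φ : EuclideanSpace ℝ (Fin N) → ℝ≥0∞)
    (x : EuclideanSpace ℝ (Fin N)) : ℝ≥0∞ :=
  ∫⁻ y, ENNReal.ofReal (heatKernel t (x - y)) * φ y

lemma heatEvol_eq_heatOp (t : ℝ) (φ : EuclideanSpace ℝ (Fin N) → ℝ) :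
    heatEvol t φ = heatOp t fun y => ENNReal.ofReal (φ y) := rfl

lemma measurable_heatOp (hφ : Measurable φ) :
    Measurable fun p : ℝ × EuclideanSpace ℝ (Fin N) => heatOp p.1 φ p.2 := by
  refine Measurable.lintegral_prod_right' (f := fun z :
    (ℝ × EuclideanSpace ℝ (Fin N)) × EuclideanSpace ℝ (Fin N) =>
      ENNReal.ofReal (heatKernel z.1.1 (z.1.2 - z.2)) * φ z.2) ?_
  unfold heatKernel
  fun_prop

lemma heatOp_mono (t : ℝ) (h : φ ≤ ψ) : heatOp t φ ≤ heatOp t ψ := fun _ =>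
  lintegral_mono fun y => mul_le_mul_right (h y) _

lemma heatOp_congr_ae (t : ℝ) (h : φ =ᵐ[volume] ψ) : heatOp t φ = heatOp t ψ :=
  funext fun _ => lintegral_congr_ae (h.mono fun y hy => by simp only [hy])

lemma heatOp_const (ht : 0 < t) (c : ℝ≥0∞) (x : EuclideanSpace ℝ (Fin N)) :
    heatOp t (fun _ => c) x = c := by
  rw [heatOp, lintegral_mul_const _ (measurable_heatKernel_sub t x),
    lintegral_heatKernel_sub ht, one_mul]

lemma heatOp_add_left (t : ℝ) (hφ : Measurable φ) (ψ : EuclideanSpace ℝ (Fin N) → ℝ≥0∞)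
    (x : EuclideanSpace ℝ (Fin N)) :
    heatOp t (fun y => φ y + ψ y) x = heatOp t φ x + heatOp t ψ x := by
  simp_rw [heatOp, mul_add]
  exact lintegral_add_left ((measurable_heatKernel_sub t x).mul hφ) _

lemma heatOp_const_add (ht : 0 < t) (c : ℝ≥0∞) (φ : EuclideanSpace ℝ (Fin N) → ℝ≥0∞)
    (x : EuclideanSpace ℝ (Fin N)) : heatOp t (fun y => c + φ y) x = c + heatOp t φ x := by
  rw [heatOp_add_left t measurable_const, heatOp_const ht]

lemma heatOp_const_mul (t : ℝ) {c : ℝ≥0∞} (hc : c ≠ ∞)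
    (φ : EuclideanSpace ℝ (Fin N) → ℝ≥0∞) (x : EuclideanSpace ℝ (Fin N)) :
    heatOp t (fun y => c * φ y) x = c * heatOp t φ x := by
  simp_rw [heatOp, mul_left_comm _ c]
  exact lintegral_const_mul' _ _ hc

/-- The uniformly local mass `sup_y ∫_{B(y,1)} φ` of a `[0, ∞]`-valued function, so that
`ulNorm φ` is the uniformly local mass of `|φ|`. -/
noncomputable def ulMass (φ : EuclideanSpace ℝ (Fin N) → ℝ≥0∞) : ℝ≥0∞ :=
  ⨆ y, ∫⁻ x in Metric.ball y 1, φ x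

lemma setLIntegral_le_ulMass (φ : EuclideanSpace ℝ (Fin N) → ℝ≥0∞)
    (y : EuclideanSpace ℝ (Fin N)) : ∫⁻ x in Metric.ball y 1, φ x ≤ ulMass φ :=
  le_iSup (fun y => ∫⁻ x in Metric.ball y 1, φ x) y

lemma ulNorm_eq_ulMass (φ : EuclideanSpace ℝ (Fin N) → ℝ) : ulNorm φ = ulMass fun x => ‖φ x‖ₑ :=
  rfl

lemma ulMass_mono (h : φ ≤ ψ) : ulMass φ ≤ ulMass ψ := iSup_mono fun _ => lintegral_mono h

lemma ulMass_congr_ae (h : φ =ᵐ[volume] ψ) : ulMass φ = ulMass ψ :=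
  iSup_congr fun _ => lintegral_congr_ae (ae_restrict_of_ae h)

lemma ulMass_const (c : ℝ≥0∞) : ulMass (fun _ : EuclideanSpace ℝ (Fin N) => c) =
    c * volume (Metric.ball (0 : EuclideanSpace ℝ (Fin N)) 1) := by
  simp_rw [ulMass, setLIntegral_const, Measure.addHaar_ball_center volume]
  exact ciSup_const

lemma ulMass_add_le (hφ : Measurable φ) (ψ : EuclideanSpace ℝ (Fin N) → ℝ≥0∞) :
    ulMass (fun x => φ x + ψ x) ≤ ulMass φ + ulMass ψ :=
  iSup_le fun y => by
    rw [lintegral_add_left hφ]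
    exact add_le_add (setLIntegral_le_ulMass φ y) (setLIntegral_le_ulMass ψ y)

lemma ulMass_const_mul (c : ℝ≥0∞) (hφ : Measurable φ) :
    ulMass (fun x => c * φ x) = c * ulMass φ := by
  simp_rw [ulMass, lintegral_const_mul c hφ, ENNReal.mul_iSup]

lemma ulMass_comp_sub_right (φ : EuclideanSpace ℝ (Fin N) → ℝ≥0∞)
    (z : EuclideanSpace ℝ (Fin N)) : ulMass (fun x => φ (x - z)) ≤ ulMass φ := by
  refine iSup_le fun y => (le_of_eq ?_).trans (setLIntegral_le_ulMass φ (y - z))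
  rw [← lintegral_indicator measurableSet_ball, ← lintegral_indicator measurableSet_ball,
    ← lintegral_sub_right_eq_self ((Metric.ball (y - z) 1).indicator φ) z]
  simp only [indicator, Metric.mem_ball, dist_sub_right]

lemma ulMass_heatOp_le (ht : 0 < t) (hφ : Measurable φ) : ulMass (heatOp t φ) ≤ ulMass φ := by
  refine iSup_le fun y => ?_
  have hconv : ∀ x, heatOp t φ x = ∫⁻ z, ENNReal.ofReal (heatKernel t z) * φ (x - z) := by
    intro x
    rw [heatOp, ← lintegral_sub_left_eq_self _ x]
    simp only [sub_sub_cancel]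
  simp_rw [hconv]
  have hmeas : Measurable fun p : EuclideanSpace ℝ (Fin N) × EuclideanSpace ℝ (Fin N) =>
      ENNReal.ofReal (heatKernel t p.2) * φ (p.1 - p.2) := by
    unfold heatKernel
    fun_prop
  rw [lintegral_lintegral_swap hmeas.aemeasurable]
  calc ∫⁻ z, ∫⁻ x in Metric.ball y 1, ENNReal.ofReal (heatKernel t z) * φ (x - z)
      ≤ ∫⁻ z : EuclideanSpace ℝ (Fin N), ENNReal.ofReal (heatKernel t z) * ulMass φ := by
        refine lintegral_mono fun z => ?_
        rw [lintegral_const_mul' _ _ ENNReal.ofReal_ne_top]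
        gcongr
        exact (setLIntegral_le_ulMass _ y).trans (ulMass_comp_sub_right φ z)
    _ = ulMass φ := by
        rw [lintegral_mul_const _ (by unfold heatKernel; fun_prop), lintegral_heatKernel ht,
          one_mul]

lemma heatKernel_le_of_norm_le_add_one (ht : 0 < t) (ht1 : t ≤ 1)
    {z v : EuclideanSpace ℝ (Fin N)} (hzv : ‖v‖ ≤ ‖z‖ + 1) :
    heatKernel t z ≤ Real.exp (1 / 4) * (2 / t) ^ ((N : ℝ) / 2) * heatKernel 2 v := by
  have hprefactor : (4 * Real.pi * t) ^ (-(N : ℝ) / 2) =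
      (2 / t) ^ ((N : ℝ) / 2) * (4 * Real.pi * 2) ^ (-(N : ℝ) / 2) := by
    rw [neg_div, ← inv_div t 2, Real.inv_rpow (by positivity), ← Real.rpow_neg (by positivity),
      ← Real.mul_rpow (by positivity) (by positivity)]
    congr 1
    field_simp
  have hexponent : -‖z‖ ^ 2 / (4 * t) ≤ 1 / 4 + -‖v‖ ^ 2 / (4 * 2) := by
    have hv : ‖v‖ ^ 2 ≤ (‖z‖ + 1) ^ 2 := by gcongr
    have hz : ‖z‖ ^ 2 / 4 ≤ ‖z‖ ^ 2 / (4 * t) :=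
      div_le_div_of_nonneg_left (by positivity) (by positivity) (by linarith)
    rw [neg_div]
    nlinarith [sq_nonneg (‖z‖ - 1)]
  calc heatKernel t z
      ≤ (4 * Real.pi * t) ^ (-(N : ℝ) / 2) * Real.exp (1 / 4 + -‖v‖ ^ 2 / (4 * 2)) :=
        mul_le_mul_of_nonneg_left (Real.exp_le_exp.2 hexponent) (by positivity)
    _ = _ := by
        rw [hprefactor, Real.exp_add, heatKernel]
        ring

lemma lintegral_setLIntegral_ball_mul {X : Type*} [PseudoMetricSpace X]
    [SecondCountableTopology X] [MeasurableSpace X] [OpensMeasurableSpace X] {μ : Measure X}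
    [SFinite μ] {φ ψ : X → ℝ≥0∞} (hφ : Measurable φ) (hψ : Measurable ψ) (R : ℝ) :
    ∫⁻ y, (∫⁻ w in Metric.ball y R, ψ w ∂μ) * φ y ∂μ =
      ∫⁻ w, ψ w * ∫⁻ y in Metric.ball w R, φ y ∂μ ∂μ := by
  have hset : MeasurableSet {p : X × X | dist p.2 p.1 < R} :=
    measurableSet_lt (by fun_prop) measurable_const
  calc ∫⁻ y, (∫⁻ w in Metric.ball y R, ψ w ∂μ) * φ y ∂μ
      = ∫⁻ y, ∫⁻ w, {p : X × X | dist p.2 p.1 < R}.indicator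
          (fun p => ψ p.2 * φ p.1) (y, w) ∂μ ∂μ := by
        refine lintegral_congr fun y => ?_
        rw [← lintegral_mul_const _ hψ, ← lintegral_indicator measurableSet_ball]
        rfl
    _ = ∫⁻ w, ∫⁻ y, {p : X × X | dist p.2 p.1 < R}.indicator
          (fun p => ψ p.2 * φ p.1) (y, w) ∂μ ∂μ := by
        refine lintegral_lintegral_swap (Measurable.aemeasurable ?_)
        exact Measurable.indicator (by fun_prop) hset
    _ = ∫⁻ w, ψ w * ∫⁻ y in Metric.ball w R, φ y ∂μ ∂μ := by
        refine lintegral_congr fun w => ?_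
        rw [← lintegral_const_mul _ hφ, ← lintegral_indicator measurableSet_ball]
        simp only [indicator, Metric.mem_ball, mem_ofPred_eq, dist_comm w]

lemma heatOp_mul_volume_ball_le (ht : 0 < t) (ht1 : t ≤ 1) (hφ : Measurable φ)
    (x : EuclideanSpace ℝ (Fin N)) :
    heatOp t φ x * volume (Metric.ball (0 : EuclideanSpace ℝ (Fin N)) 1) ≤
      ENNReal.ofReal (Real.exp (1 / 4) * (2 / t) ^ ((N : ℝ) / 2)) * ulMass φ := by
  set A := ENNReal.ofReal (Real.exp (1 / 4) * (2 / t) ^ ((N : ℝ) / 2)) with hA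
  have hkernel : ∀ y, ENNReal.ofReal (heatKernel t (x - y)) *
      volume (Metric.ball (0 : EuclideanSpace ℝ (Fin N)) 1) ≤
      ∫⁻ w in Metric.ball y 1, A * ENNReal.ofReal (heatKernel 2 (x - w)) := by
    intro y
    rw [← Measure.addHaar_ball_center volume y, ← setLIntegral_const]
    refine setLIntegral_mono' measurableSet_ball fun w hw => ?_
    rw [hA, ← ENNReal.ofReal_mul (by positivity)]
    refine ENNReal.ofReal_le_ofReal (heatKernel_le_of_norm_le_add_one ht ht1 ?_)
    rw [← dist_eq_norm, ← dist_eq_norm]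
    linarith [dist_triangle x y w, dist_comm w y, Metric.mem_ball.1 hw]
  calc heatOp t φ x * volume (Metric.ball (0 : EuclideanSpace ℝ (Fin N)) 1)
      = ∫⁻ y, ENNReal.ofReal (heatKernel t (x - y)) *
          volume (Metric.ball (0 : EuclideanSpace ℝ (Fin N)) 1) * φ y := by
        rw [heatOp, ← lintegral_mul_const' _ _ measure_ball_lt_top.ne]
        simp_rw [mul_right_comm]
    _ ≤ ∫⁻ y, (∫⁻ w in Metric.ball y 1, A * ENNReal.ofReal (heatKernel 2 (x - w))) * φ y :=
        lintegral_mono fun y => mul_le_mul_left (hkernel y) _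
    _ = ∫⁻ w, A * ENNReal.ofReal (heatKernel 2 (x - w)) * ∫⁻ y in Metric.ball w 1, φ y :=
        lintegral_setLIntegral_ball_mul hφ ((measurable_heatKernel_sub 2 x).const_mul A) 1
    _ ≤ ∫⁻ w, A * ENNReal.ofReal (heatKernel 2 (x - w)) * ulMass φ := by
        gcongr with w
        exact setLIntegral_le_ulMass φ w
    _ = A * ulMass φ := by
        rw [lintegral_mul_const _ ((measurable_heatKernel_sub 2 x).const_mul A),
          lintegral_const_mul _ (measurable_heatKernel_sub 2 x),
          lintegral_heatKernel_sub two_pos, mul_one]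

/-- The pointwise bound `e^{tΔ} φ ≤ K t^{-α}` for the times `t ∈ I`. -/
def HeatDecayOn (I : Set ℝ) (φ : EuclideanSpace ℝ (Fin N) → ℝ≥0∞) (K α : ℝ) : Prop :=
  ∀ t ∈ I, ∀ x, heatOp t φ x ≤ ENNReal.ofReal (K * t ^ (-α))

lemma HeatDecayOn.mono {I J : Set ℝ} {K α : ℝ} (h : HeatDecayOn J φ K α) (hIJ : I ⊆ J) :
    HeatDecayOn I φ K α := fun t ht => h t (hIJ ht)

lemma exists_heatDecayOn_of_ulMass_le (N : ℕ) : ∃ C : ℝ, 0 < C ∧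
    ∀ (φ : EuclideanSpace ℝ (Fin N) → ℝ≥0∞) (M : ℝ≥0), AEMeasurable φ → ulMass φ ≤ M →
      HeatDecayOn (Ioc 0 1) φ (C * M) (N / 2) := by
  set V := volume (Metric.ball (0 : EuclideanSpace ℝ (Fin N)) 1)
  have hVtop : V ≠ ∞ := measure_ball_lt_top.ne
  have hV : V ≠ 0 := (Metric.measure_ball_pos _ _ one_pos).ne'
  have hVreal : 0 < V.toReal := ENNReal.toReal_pos hV hVtop
  refine ⟨Real.exp (1 / 4) * 2 ^ ((N : ℝ) / 2) / V.toReal, by positivity, ?_⟩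
  intro φ M hφ hM t ht x
  have ht0 : 0 < t := ht.1
  rw [ulMass_congr_ae hφ.ae_eq_mk] at hM
  rw [heatOp_congr_ae t hφ.ae_eq_mk, ← ENNReal.mul_le_mul_iff_left hV hVtop]
  refine (heatOp_mul_volume_ball_le ht0 ht.2 hφ.measurable_mk x).trans
    ((mul_le_mul_right hM _).trans_eq ?_)
  have hVofReal : V = ENNReal.ofReal V.toReal := (ENNReal.ofReal_toReal hVtop).symm
  rw [hVofReal, ENNReal.toReal_ofReal hVreal.le, ← ENNReal.ofReal_coe_nnreal,
    ← ENNReal.ofReal_mul (by positivity), ← ENNReal.ofReal_mul (by positivity),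
    Real.div_rpow zero_le_two ht0.le, Real.rpow_neg ht0.le]
  congr 1
  field_simp

lemma heatKernel_smul (ht : 0 < t) {c : ℝ} (hc : 0 < c) (z : EuclideanSpace ℝ (Fin N)) :
    heatKernel (c ^ 2 * t) (c • z) = (c ^ N)⁻¹ * heatKernel t z := by
  have hpow : (c ^ 2) ^ (-(N : ℝ) / 2) = (c ^ N)⁻¹ := by
    rw [← Real.rpow_natCast c 2, ← Real.rpow_mul hc.le, ← Real.rpow_natCast c N,
      ← Real.rpow_neg hc.le]
    congr 1
    push_cast
    ring
  rw [heatKernel, heatKernel, norm_smul, Real.norm_of_nonneg hc.le, mul_left_comm,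
    Real.mul_rpow (by positivity) (by positivity), hpow, mul_assoc, mul_pow, mul_left_comm 4,
    ← mul_neg, mul_div_mul_left _ _ (by positivity)]

lemma heatOp_smul (ht : 0 < t) {c : ℝ} (hc : 0 < c) (φ : EuclideanSpace ℝ (Fin N) → ℝ≥0∞)
    (x : EuclideanSpace ℝ (Fin N)) :
    heatOp (c ^ 2 * t) φ (c • x) = heatOp t (fun y => φ (c • y)) x := by
  have hembed : MeasurableEmbedding fun y : EuclideanSpace ℝ (Fin N) => c • y :=
    (Homeomorph.smulOfNeZero c hc.ne').measurableEmbedding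
  have hvol : (volume : Measure (EuclideanSpace ℝ (Fin N))) =
      ENNReal.ofReal (c ^ N) • Measure.map (fun y => c • y) volume := by
    rw [Measure.map_addHaar_smul volume hc.ne', smul_smul, ← ENNReal.ofReal_mul (by positivity),
      finrank_euclideanSpace, Fintype.card_fin, abs_of_pos (by positivity),
      mul_inv_cancel₀ (by positivity), ENNReal.ofReal_one, one_smul]
  rw [heatOp, hvol, lintegral_smul_measure, hembed.lintegral_map, smul_eq_mul,
    ← lintegral_const_mul' _ _ ENNReal.ofReal_ne_top, heatOp]
  refine lintegral_congr fun y => ?_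
  rw [← smul_sub, heatKernel_smul ht hc, ← mul_assoc, ← ENNReal.ofReal_mul (by positivity),
    mul_inv_cancel_left₀ (by positivity)]

lemma heatDecayOn_of_homogeneous {K α : ℝ} (hα : ∀ c : ℝ, 0 < c → ∀ y,
      φ (c • y) = ENNReal.ofReal (c ^ (-(2 * α))) * φ y)
    (h1 : ∀ x, heatOp 1 φ x ≤ ENNReal.ofReal K) : HeatDecayOn (Ioi 0) φ K α := by
  intro t ht x
  have ht : 0 < t := ht
  have hc : 0 < √t := Real.sqrt_pos.2 ht
  have hscale := heatOp_smul one_pos hc φ ((√t)⁻¹ • x)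
  simp_rw [hα _ hc] at hscale
  rw [heatOp_const_mul _ ENNReal.ofReal_ne_top, smul_inv_smul₀ hc.ne', Real.sq_sqrt ht.le,
    mul_one] at hscale
  have hpow : √t ^ (-(2 * α)) = t ^ (-α) := by
    rw [Real.sqrt_eq_rpow, ← Real.rpow_mul ht.le]
    ring_nf
  rw [hscale, hpow, mul_comm K, ENNReal.ofReal_mul (by positivity)]
  gcongr
  exact h1 _

lemma ulMass_norm_rpow_lt_top (hN : 1 ≤ N) {γ : ℝ} (hγ0 : 0 ≤ γ) (hγ : γ < N) :
    ulMass (fun y : EuclideanSpace ℝ (Fin N) => ENNReal.ofReal (‖y‖ ^ (-γ))) < ∞ := by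
  have hsplit : (fun y : EuclideanSpace ℝ (Fin N) => ENNReal.ofReal (‖y‖ ^ (-γ))) ≤
      fun y => 1 + (Metric.ball 0 1).indicator (fun y => ENNReal.ofReal (‖y‖ ^ (-γ))) y := by
    intro y
    by_cases hy : y ∈ Metric.ball (0 : EuclideanSpace ℝ (Fin N)) 1
    · simp only [indicator_of_mem hy, le_add_self]
    · refine le_add_right (ENNReal.ofReal_le_one.2 ?_)
      exact Real.rpow_le_one_of_one_le_of_nonpos (by simpa using hy) (by linarith)
  have hnear : ∫⁻ y in Metric.ball (0 : EuclideanSpace ℝ (Fin N)) 1,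
      ENNReal.ofReal (‖y‖ ^ (-γ)) < ∞ := by
    refine (lintegral_mono fun y => Real.ofReal_le_enorm _).trans_lt (IntegrableOn.integrable
      (integrableOn_ball_of_norm_le_rpow (C := 1) (α := γ) ?_ ?_ (ae_of_all _ fun y => ?_)
        (measurable_norm.pow_const _).aestronglyMeasurable)).2
    · rwa [finrank_euclideanSpace_fin]
    · rwa [finrank_euclideanSpace_fin]
    · rw [one_mul, Real.norm_of_nonneg (by positivity)]
  refine (ulMass_mono hsplit).trans_lt ((ulMass_add_le measurable_const _).trans_lt ?_)
  rw [ulMass_const, one_mul]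
  refine ENNReal.add_lt_top.2 ⟨measure_ball_lt_top, (iSup_le fun z => ?_).trans_lt hnear⟩
  exact (setLIntegral_le_lintegral _ _).trans_eq (lintegral_indicator measurableSet_ball _)

lemma exists_heatDecayOn_norm_rpow (hN : 1 ≤ N) {γ : ℝ} (hγ0 : 0 ≤ γ) (hγ : γ < N) :
    ∃ K : ℝ, 0 ≤ K ∧ HeatDecayOn (Ioi 0)
      (fun y : EuclideanSpace ℝ (Fin N) => ENNReal.ofReal (‖y‖ ^ (-γ))) K (γ / 2) := by
  obtain ⟨C, hC, hdecay⟩ := exists_heatDecayOn_of_ulMass_le N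
  have hmass := ulMass_norm_rpow_lt_top hN hγ0 hγ
  refine ⟨C * (ulMass fun y : EuclideanSpace ℝ (Fin N) => ENNReal.ofReal (‖y‖ ^ (-γ))).toNNReal,
    by positivity, heatDecayOn_of_homogeneous ?_ fun x => ?_⟩
  · intro c hc y
    rw [← ENNReal.ofReal_mul (by positivity), norm_smul, Real.norm_of_nonneg hc.le,
      Real.mul_rpow hc.le (norm_nonneg _), mul_div_cancel₀ _ two_ne_zero]
  · simpa only [Real.one_rpow, mul_one] using hdecay _ _ (by fun_prop)
      (ENNReal.coe_toNNReal hmass.ne).ge 1 ⟨one_pos, le_rfl⟩ x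

lemma heatKernel_mul_heatKernel (hs : 0 < s) (hst : s < t)
    (x y w : EuclideanSpace ℝ (Fin N)) :
    heatKernel (t - s) (x - y) * heatKernel s (y - w) =
      heatKernel t (x - w) *
        heatKernel (s * (t - s) / t) ((s / t) • x + ((t - s) / t) • w - y) := by
  have ht : 0 < t := hs.trans hst
  have hts : 0 < t - s := sub_pos.2 hst
  obtain ⟨a, rfl⟩ : ∃ a, x = a + y := ⟨x - y, by simp⟩
  obtain ⟨b, rfl⟩ : ∃ b, w = y - b := ⟨y - w, by simp⟩
  have hsum : a + y - (y - b) = a + b := by abel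
  have hmean : (s / t) • (a + y) + ((t - s) / t) • (y - b) - y =
      (s / t) • a - ((t - s) / t) • b := by
    have hy : (s / t) • y + ((t - s) / t) • y = y := by
      rw [← add_smul, ← add_div, add_sub_cancel, div_self ht.ne', one_smul]
    rw [smul_add, smul_sub]
    nth_rewrite 3 [← hy]
    abel
  rw [hsum, hmean, add_sub_cancel_right, sub_sub_cancel]
  simp only [heatKernel]
  rw [mul_mul_mul_comm, mul_mul_mul_comm (_ ^ _) _ (_ ^ _), ← Real.exp_add, ← Real.exp_add,
    ← Real.mul_rpow (by positivity) (by positivity),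
    ← Real.mul_rpow (by positivity) (by positivity)]
  congr 2
  · field_simp
  · rw [norm_add_sq_real, norm_sub_sq_real, norm_smul, norm_smul, real_inner_smul_left,
      real_inner_smul_right, Real.norm_of_nonneg (by positivity),
      Real.norm_of_nonneg (by positivity)]
    field_simp
    ring

lemma heatOp_mul_heatOp {a h : EuclideanSpace ℝ (Fin N) → ℝ≥0∞} (ha : Measurable a)
    (hh : Measurable h) (hs : 0 < s) (hst : s < t) (x : EuclideanSpace ℝ (Fin N)) :
    heatOp (t - s) (fun y => a y * heatOp s h y) x =
      ∫⁻ w, ENNReal.ofReal (heatKernel t (x - w)) * h w *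
        heatOp (s * (t - s) / t) a ((s / t) • x + ((t - s) / t) • w) := by
  have hmeas : Measurable fun p : EuclideanSpace ℝ (Fin N) × EuclideanSpace ℝ (Fin N) =>
      ENNReal.ofReal (heatKernel (t - s) (x - p.1)) * a p.1 *
        (ENNReal.ofReal (heatKernel s (p.1 - p.2)) * h p.2) := by
    unfold heatKernel
    fun_prop
  have hbridge (y w : EuclideanSpace ℝ (Fin N)) :
      ENNReal.ofReal (heatKernel (t - s) (x - y)) * ENNReal.ofReal (heatKernel s (y - w)) =
        ENNReal.ofReal (heatKernel t (x - w)) * ENNReal.ofReal (heatKernel (s * (t - s) / t)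
          ((s / t) • x + ((t - s) / t) • w - y)) := by
    rw [← ENNReal.ofReal_mul (heatKernel_nonneg (sub_pos.2 hst) _),
      ← ENNReal.ofReal_mul (heatKernel_nonneg (hs.trans hst) _),
      heatKernel_mul_heatKernel hs hst]
  calc heatOp (t - s) (fun y => a y * heatOp s h y) x
      = ∫⁻ y, ∫⁻ w, ENNReal.ofReal (heatKernel (t - s) (x - y)) * a y *
          (ENNReal.ofReal (heatKernel s (y - w)) * h w) := by
        refine lintegral_congr fun y => ?_
        rw [lintegral_const_mul _ ((measurable_heatKernel_sub s y).fun_mul hh), mul_assoc]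
        rfl
    _ = ∫⁻ w, ∫⁻ y, ENNReal.ofReal (heatKernel (t - s) (x - y)) * a y *
          (ENNReal.ofReal (heatKernel s (y - w)) * h w) :=
        lintegral_lintegral_swap hmeas.aemeasurable
    _ = _ := by
        refine lintegral_congr fun w => ?_
        rw [heatOp, ← lintegral_const_mul _ ((measurable_heatKernel_sub _ _).fun_mul ha)]
        refine lintegral_congr fun y => ?_
        rw [mul_mul_mul_comm, hbridge]
        ring

lemma heatOp_mul_heatOp_le {a h : EuclideanSpace ℝ (Fin N) → ℝ≥0∞} {K β : ℝ}
    (ha : Measurable a) (hdecay : HeatDecayOn (Ioi 0) a K β) (hh : Measurable h)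
    (hs : 0 < s) (hst : s < t) (x : EuclideanSpace ℝ (Fin N)) :
    heatOp (t - s) (fun y => a y * heatOp s h y) x ≤
      ENNReal.ofReal (K * (s * (t - s) / t) ^ (-β)) * heatOp t h x := by
  have hτ : 0 < s * (t - s) / t := div_pos (mul_pos hs (sub_pos.2 hst)) (hs.trans hst)
  rw [heatOp_mul_heatOp ha hh hs hst, mul_comm (ENNReal.ofReal _), heatOp,
    ← lintegral_mul_const' _ _ ENNReal.ofReal_ne_top]
  exact lintegral_mono fun w => mul_le_mul_right (hdecay _ hτ _) _

lemma heatOp_mul_heatOp_add_heatOp_le {a h : EuclideanSpace ℝ (Fin N) → ℝ≥0∞} {K β : ℝ}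
    (ha : Measurable a) (hdecay : HeatDecayOn (Ioi 0) a K β) (hK : 0 ≤ K) (hβ : 0 ≤ β)
    (hh : Measurable h) (hs : 0 < s) (hst : s < t) {x : EuclideanSpace ℝ (Fin N)}
    (hfin : heatOp t h x ≠ ∞) :
    heatOp (t - s) (fun y => a y * (heatOp t h x + heatOp s h y)) x ≤
      ENNReal.ofReal (2 * K * (s * (t - s) / t) ^ (-β)) * heatOp t h x := by
  have ht : 0 < t := hs.trans hst
  have hts : 0 < t - s := sub_pos.2 hst
  have hsub : s * (t - s) / t ≤ t - s := by
    rw [div_le_iff₀ ht]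
    nlinarith
  have hfirst : heatOp (t - s) a x ≤ ENNReal.ofReal (K * (s * (t - s) / t) ^ (-β)) :=
    (hdecay _ hts x).trans (ENNReal.ofReal_le_ofReal (mul_le_mul_of_nonneg_left
      (Real.rpow_le_rpow_of_nonpos (by positivity) hsub (by linarith)) hK))
  simp_rw [mul_add, mul_comm _ (heatOp t h x)]
  rw [heatOp_add_left _ (ha.const_mul _), heatOp_const_mul _ hfin, mul_assoc 2, two_mul,
    ENNReal.ofReal_add (by positivity) (by positivity), mul_add]
  gcongr
  exact (heatOp_mul_heatOp_le ha hdecay hh hs hst x).trans_eq (mul_comm _ _)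

end Heat

section Barrier

lemma lintegral_rpow_mul_one_sub_rpow {a b : ℝ} (ha : a < 1) (hb : b < 1) :
    ∫⁻ s in Ioo (0 : ℝ) 1, ENNReal.ofReal (s ^ (-a) * (1 - s) ^ (-b)) =
      ENNReal.ofReal (ProbabilityTheory.beta (1 - a) (1 - b)) := by
  have hbeta := ProbabilityTheory.beta_pos (sub_pos.2 ha) (sub_pos.2 hb)
  have hmass := ProbabilityTheory.lintegral_betaPDF_eq_one (sub_pos.2 ha) (sub_pos.2 hb)
  simp_rw [ProbabilityTheory.lintegral_betaPDF, mul_assoc, ENNReal.ofReal_mul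
    (one_div_nonneg.2 hbeta.le), show ∀ c : ℝ, 1 - c - 1 = -c by intro c; ring] at hmass
  rw [lintegral_const_mul' _ _ ENNReal.ofReal_ne_top] at hmass
  rw [← mul_one (ENNReal.ofReal _), ← hmass, ← mul_assoc, ← ENNReal.ofReal_mul hbeta.le,
    mul_one_div_cancel hbeta.ne', ENNReal.ofReal_one, one_mul]

lemma lintegral_rpow_mul_sub_rpow {a b t : ℝ} (ha : a < 1) (hb : b < 1) (ht : 0 < t) :
    ∫⁻ s in Ioo 0 t, ENNReal.ofReal (s ^ (-a) * (t - s) ^ (-b)) =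
      ENNReal.ofReal (ProbabilityTheory.beta (1 - a) (1 - b) * t ^ (1 - a - b)) := by
  have himage : (t * ·) '' Ioo 0 1 = Ioo 0 t := by
    rw [image_mul_left_Ioo ht, mul_zero, mul_one]
  have hscale : ∀ s ∈ Ioo (0 : ℝ) 1,
      ENNReal.ofReal |t| * ENNReal.ofReal ((t * s) ^ (-a) * (t - t * s) ^ (-b)) =
        ENNReal.ofReal (t ^ (1 - a - b)) * ENNReal.ofReal (s ^ (-a) * (1 - s) ^ (-b)) := by
    intro s hs
    have hs0 : 0 < s := hs.1
    have hs1 : 0 < 1 - s := sub_pos.2 hs.2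
    have hpow : t ^ (1 - a - b) = t * (t ^ (-a) * t ^ (-b)) := by
      rw [← Real.rpow_add ht, sub_sub, sub_eq_add_neg, neg_add, Real.rpow_add ht, Real.rpow_one]
    rw [← ENNReal.ofReal_mul (by positivity), ← ENNReal.ofReal_mul (by positivity),
      abs_of_pos ht, ← mul_one_sub, Real.mul_rpow ht.le hs0.le, Real.mul_rpow ht.le hs1.le, hpow]
    ring_nf
  rw [← himage, lintegral_image_eq_lintegral_abs_deriv_mul measurableSet_Ioo
      (fun s _ => (hasDerivAt_const_mul t).hasDerivWithinAt) (mul_right_injective₀ ht.ne').injOn,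
    setLIntegral_congr_fun measurableSet_Ioo hscale,
    lintegral_const_mul' _ _ ENNReal.ofReal_ne_top, lintegral_rpow_mul_one_sub_rpow ha hb,
    ← ENNReal.ofReal_mul (by positivity), mul_comm]

variable {N : ℕ} {q r p ξ α E s t T : ℝ} {f : ℝ → ℝ} {h : EuclideanSpace ℝ (Fin N) → ℝ≥0∞}
  {x y : EuclideanSpace ℝ (Fin N)}

lemma HeatDecayOn.heatOp_ne_top {I : Set ℝ} (hdecay : HeatDecayOn I h E α) (ht : t ∈ I)
    (x : EuclideanSpace ℝ (Fin N)) : heatOp t h x ≠ ∞ :=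
  ((hdecay t ht x).trans_lt ENNReal.ofReal_lt_top).ne

lemma HeatDecayOn.toReal_heatOp_le {I : Set ℝ} (hdecay : HeatDecayOn I h E α) (hE : 0 ≤ E)
    (ht0 : 0 ≤ t) (ht : t ∈ I) (x : EuclideanSpace ℝ (Fin N)) :
    (heatOp t h x).toReal ≤ E * t ^ (-α) :=
  ENNReal.toReal_le_of_le_ofReal (by positivity) (hdecay t ht x)

lemma le_toReal_heatOp {c : ℝ} (ht : 0 < t) (hc : ∀ y, ENNReal.ofReal c ≤ h y)
    (hfin : heatOp t h x ≠ ∞) : c ≤ (heatOp t h x).toReal := by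
  rw [← ENNReal.ofReal_le_iff_le_toReal hfin, ← heatOp_const ht (ENNReal.ofReal c) x]
  exact heatOp_mono t hc x

/-- The majorant `F(ξ)^{-r} + F(u)^{-r}` of the function `u ↦ F(max u ξ)^{-r}`, which is convex
when `ξ` is large. -/
noncomputable def shiftedNegPowF (f : ℝ → ℝ) (r ξ u : ℝ) : ℝ≥0∞ :=
  ENNReal.ofReal (negPowF f r ξ) + ENNReal.ofReal (negPowF f r u)

lemma ofReal_negPowF_le_shiftedNegPowF (f : ℝ → ℝ) (r ξ u : ℝ) :
    ENNReal.ofReal (negPowF f r ξ) ≤ shiftedNegPowF f r ξ u := le_self_add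

lemma ofReal_negPowF_max_le_shiftedNegPowF (f : ℝ → ℝ) (r ξ u : ℝ) :
    ENNReal.ofReal (negPowF f r (max u ξ)) ≤ shiftedNegPowF f r ξ u := by
  rcases max_choice u ξ with hmax | hmax <;> rw [hmax]
  · exact le_add_self
  · exact le_self_add

lemma measurable_shiftedNegPowF (f : ℝ → ℝ) (r ξ : ℝ) : Measurable (shiftedNegPowF f r ξ) :=
  (measurable_negPowF f r).ennreal_ofReal.const_add _

/-- Jensen's inequality for the heat semigroup and the convex function `F^{-r}`. -/
lemma ClassS.heatOp_le_negPowInv (hf : ClassS q f) (hr : 0 < r) (hξ : 0 < ξ)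
    (hconv : ConvexOn ℝ (Ici ξ) (negPowF f r)) {u₀ : EuclideanSpace ℝ (Fin N) → ℝ} {z : ℝ}
    (ht : 0 < t) (hz : negPowF f r ξ ≤ z)
    (hle : heatOp t (fun y => shiftedNegPowF f r ξ (u₀ y)) x ≤ ENNReal.ofReal z) :
    heatOp t (fun y => ENNReal.ofReal (u₀ y)) x ≤ ENNReal.ofReal (negPowInv f r z) := by
  set w := negPowInv f r z
  have hξw : ξ ≤ w := hf.le_negPowInv hr hξ hz
  have hGw : negPowF f r w = z := hf.negPowF_negPowInv hr hξ hz
  have hw0 := hξ.trans_le hξw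
  have hfw := hf.pos w hw0
  have hFw := hf.tailReal_pos hw0
  have hz0 : 0 < z := (hf.negPowF_pos r hξ).trans_le hz
  set D := f w * tailReal f w / (r * z) with hD
  have hD0 : 0 ≤ D := by positivity
  have hDz : f w * tailReal f w / r = D * z := by
    rw [hD]
    field_simp
  have htangent : ∀ y, ENNReal.ofReal (D * z) + ENNReal.ofReal (u₀ y) ≤
      ENNReal.ofReal w + ENNReal.ofReal D * shiftedNegPowF f r ξ (u₀ y) := by
    intro y
    have htan := hf.le_tangent_negPowF hr hξ hconv hξw (le_max_right (u₀ y) ξ)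
    rw [hGw, hDz, ← hD] at htan
    calc ENNReal.ofReal (D * z) + ENNReal.ofReal (u₀ y)
        ≤ ENNReal.ofReal (D * z + max (u₀ y) ξ) := by
          rw [ENNReal.ofReal_add (by positivity) (hξ.le.trans (le_max_right _ _))]
          gcongr
          exact le_max_left _ _
      _ ≤ ENNReal.ofReal w + ENNReal.ofReal D * ENNReal.ofReal (negPowF f r (max (u₀ y) ξ)) := by
          rw [← ENNReal.ofReal_mul hD0, ← ENNReal.ofReal_add hw0.le
            (mul_nonneg hD0 (negPowF_nonneg _ _ _))]
          exact ENNReal.ofReal_le_ofReal htan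
      _ ≤ _ := by
          gcongr
          exact ofReal_negPowF_max_le_shiftedNegPowF f r ξ (u₀ y)
  have hheat := heatOp_mono t htangent x
  rw [heatOp_const_add ht, heatOp_const_add ht, heatOp_const_mul t ENNReal.ofReal_ne_top] at hheat
  refine (ENNReal.add_le_add_iff_left (ENNReal.ofReal_ne_top (r := D * z))).1 (hheat.trans ?_)
  rw [add_comm, ENNReal.ofReal_mul hD0]
  gcongr

/-- The barrier `w` determined by `F(w)^{-r} = 2 e^{tΔ} h`. -/
noncomputable def barrier (f : ℝ → ℝ) (r : ℝ) (h : EuclideanSpace ℝ (Fin N) → ℝ≥0∞) (t : ℝ)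
    (x : EuclideanSpace ℝ (Fin N)) : ℝ :=
  negPowInv f r (2 * (heatOp t h x).toReal)

lemma barrier_nonneg (f : ℝ → ℝ) (r : ℝ) (h : EuclideanSpace ℝ (Fin N) → ℝ≥0∞) (t : ℝ)
    (x : EuclideanSpace ℝ (Fin N)) : 0 ≤ barrier f r h t x := negPowInv_nonneg _ _ _

namespace ClassS

lemma le_barrier (hf : ClassS q f) (hr : 0 < r) (hξ : 0 < ξ)
    (hG : negPowF f r ξ ≤ (heatOp t h x).toReal) : ξ ≤ barrier f r h t x :=
  hf.le_negPowInv hr hξ (by linarith [negPowF_nonneg f r ξ])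

lemma negPowF_barrier (hf : ClassS q f) (hr : 0 < r) (hξ : 0 < ξ)
    (hG : negPowF f r ξ ≤ (heatOp t h x).toReal) :
    negPowF f r (barrier f r h t x) = 2 * (heatOp t h x).toReal :=
  hf.negPowF_negPowInv hr hξ (by linarith [negPowF_nonneg f r ξ])

end ClassS

namespace GrowthWindow

lemma apply_barrier_mul_le (hw : GrowthWindow f r p ξ) (hf : ClassS q f) (hr : 0 < r)
    (hhξ : ∀ y, ENNReal.ofReal (negPowF f r ξ) ≤ h y) (hE : 0 ≤ E)
    (hdecay : HeatDecayOn (Ioo 0 T) h E α) (hs : s ∈ Ioo 0 T) (ht : t ∈ Ioo 0 T) :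
    f (barrier f r h s y) * (heatOp t h x).toReal ≤
      f (barrier f r h t x) * tailReal f (barrier f r h t x) *
        ((2 * E) ^ (1 / r) * (s ^ (-(α * p / r)) * t ^ (-(α * (1 - p) / r)))) *
        ((heatOp t h x).toReal + (heatOp s h y).toReal) := by
  have hGs := le_toReal_heatOp hs.1 hhξ (hdecay.heatOp_ne_top hs y)
  have hGt := le_toReal_heatOp ht.1 hhξ (hdecay.heatOp_ne_top ht x)
  have hξb := hf.le_barrier hr hw.pos hGt
  have hb := hw.pos.trans_le hξb
  have hfb := hf.pos _ hb
  have hFb := hf.tailReal_pos hb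
  have hgrowth := hw.apply_le hf hr (hf.le_barrier hr hw.pos hGs) hξb
  rw [hf.negPowF_barrier hr hw.pos hGs, hf.negPowF_barrier hr hw.pos hGt,
    mul_div_mul_left _ _ two_ne_zero] at hgrowth
  have hY : 0 < (heatOp t h x).toReal := (hf.negPowF_pos r hw.pos).trans_le hGt
  have hpow : ∀ {τ θ : ℝ} {z : EuclideanSpace ℝ (Fin N)}, τ ∈ Ioo 0 T → 0 ≤ θ →
      (2 * (heatOp τ h z).toReal) ^ (θ / r) ≤ (2 * E) ^ (θ / r) * τ ^ (-(α * θ / r)) := by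
    intro τ θ z hτ hθ
    have hτ0 : 0 < τ := hτ.1
    calc (2 * (heatOp τ h z).toReal) ^ (θ / r) ≤ (2 * E * τ ^ (-α)) ^ (θ / r) := by
          have hle := hdecay.toReal_heatOp_le hE hτ0.le hτ z
          exact Real.rpow_le_rpow (by positivity) (by linarith) (div_nonneg hθ hr.le)
      _ = _ := by
          rw [Real.mul_rpow (by positivity) (by positivity), ← Real.rpow_mul hτ0.le]
          ring_nf
  have hEpow : (2 * E) ^ (p / r) * (2 * E) ^ ((1 - p) / r) = (2 * E) ^ (1 / r) := by
    have hp := hw.exponent_nonneg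
    have hp1 := sub_nonneg.2 hw.exponent_le_one
    rw [← Real.rpow_add_of_nonneg (by positivity) (by positivity) (by positivity), ← add_div,
      add_sub_cancel]
  have hs0 : 0 < s := hs.1
  have hpowers := mul_le_mul (hpow (z := y) hs hw.exponent_nonneg)
    (hpow (z := x) ht (sub_nonneg.2 hw.exponent_le_one)) (by positivity) (by positivity)
  rw [mul_mul_mul_comm, hEpow] at hpowers
  calc _ ≤ _ := mul_le_mul_of_nonneg_right (hgrowth.trans (mul_le_mul_of_nonneg_right
        (mul_le_mul_of_nonneg_left hpowers (by positivity)) (by positivity))) hY.le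
    _ = _ := by field_simp

variable {a : EuclideanSpace ℝ (Fin N) → ℝ≥0∞} {K β : ℝ}

lemma heatOp_mul_apply_barrier_le (hw : GrowthWindow f r p ξ) (hf : ClassS q f) (hr : 0 < r)
    (ha : Measurable a) (hK : 0 ≤ K) (hβ : 0 ≤ β) (hadecay : HeatDecayOn (Ioi 0) a K β)
    (hh : Measurable h) (hhξ : ∀ y, ENNReal.ofReal (negPowF f r ξ) ≤ h y) (hE : 0 ≤ E)
    (hdecay : HeatDecayOn (Ioo 0 T) h E α) (hs : 0 < s) (hst : s < t) (htT : t < T)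
    (x : EuclideanSpace ℝ (Fin N)) :
    heatOp (t - s) (fun y => a y * ENNReal.ofReal (f (barrier f r h s y))) x ≤
      ENNReal.ofReal (f (barrier f r h t x) * tailReal f (barrier f r h t x) *
        ((2 * E) ^ (1 / r) * (s ^ (-(α * p / r)) * t ^ (-(α * (1 - p) / r)))) *
        (2 * K * (s * (t - s) / t) ^ (-β))) := by
  have ht0 : 0 < t := hs.trans hst
  have hsT : s ∈ Ioo 0 T := ⟨hs, hst.trans htT⟩
  have hfin : ∀ {τ : ℝ} (y : EuclideanSpace ℝ (Fin N)), τ ∈ Ioo 0 T → heatOp τ h y ≠ ∞ :=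
    fun y hτ => hdecay.heatOp_ne_top hτ y
  have hxfin := hfin x ⟨ht0, htT⟩
  have hGt := le_toReal_heatOp ht0 hhξ hxfin
  have hb := hw.pos.trans_le (hf.le_barrier hr hw.pos hGt)
  have hfb := hf.pos _ hb
  have hFb := hf.tailReal_pos hb
  set P := f (barrier f r h t x) * tailReal f (barrier f r h t x) *
    ((2 * E) ^ (1 / r) * (s ^ (-(α * p / r)) * t ^ (-(α * (1 - p) / r))))
  have hP : 0 ≤ P := by positivity
  have hY : 0 < (heatOp t h x).toReal := (hf.negPowF_pos r hw.pos).trans_le hGt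
  have hpoint : ∀ y, heatOp t h x * (a y * ENNReal.ofReal (f (barrier f r h s y))) ≤
      ENNReal.ofReal P * (a y * (heatOp t h x + heatOp s h y)) := by
    intro y
    have hle := ENNReal.ofReal_le_ofReal
      (hw.apply_barrier_mul_le (x := x) (y := y) hf hr hhξ hE hdecay hsT ⟨ht0, htT⟩)
    rw [ENNReal.ofReal_mul' hY.le, ENNReal.ofReal_mul hP, ENNReal.ofReal_add hY.le
      ENNReal.toReal_nonneg, ENNReal.ofReal_toReal hxfin, ENNReal.ofReal_toReal (hfin y hsT)] at hle
    calc _ = a y * (ENNReal.ofReal (f (barrier f r h s y)) * heatOp t h x) := by ring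
      _ ≤ a y * (ENNReal.ofReal P * (heatOp t h x + heatOp s h y)) := by gcongr
      _ = _ := mul_left_comm _ _ _
  rw [← ENNReal.mul_le_mul_iff_right (ENNReal.toReal_pos_iff.1 hY).1.ne' hxfin,
    ← heatOp_const_mul _ hxfin]
  refine (heatOp_mono _ hpoint x).trans ?_
  rw [heatOp_const_mul _ ENNReal.ofReal_ne_top, ENNReal.ofReal_mul hP, mul_left_comm,
    mul_comm (heatOp t h x)]
  gcongr
  exact heatOp_mul_heatOp_add_heatOp_le ha hadecay hK hβ hh hs hst hxfin

end GrowthWindow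

/-- The constant in the bound of the Duhamel term of the barrier by `f(w) F(w)` times a power of
the time, see `GrowthWindow.lintegral_heatOp_mul_apply_barrier_le`. -/
noncomputable def barrierConst (r p α β K E : ℝ) : ℝ :=
  (2 * E) ^ (1 / r) * (2 * K) * ProbabilityTheory.beta (1 - (α * p / r + β)) (1 - β)

namespace GrowthWindow

variable {a : EuclideanSpace ℝ (Fin N) → ℝ≥0∞} {K β : ℝ}

lemma lintegral_heatOp_mul_apply_barrier_le (hw : GrowthWindow f r p ξ) (hf : ClassS q f)
    (hr : 0 < r) (ha : Measurable a) (hK : 0 ≤ K) (hβ : 0 ≤ β)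
    (hadecay : HeatDecayOn (Ioi 0) a K β) (hα : 0 ≤ α) (hpβ : α * p / r + β < 1)
    (hh : Measurable h) (hhξ : ∀ y, ENNReal.ofReal (negPowF f r ξ) ≤ h y) (hE : 0 ≤ E)
    (hdecay : HeatDecayOn (Ioo 0 T) h E α) (ht : t ∈ Ioo 0 T) (x : EuclideanSpace ℝ (Fin N)) :
    ∫⁻ s in Ioo 0 t, heatOp (t - s)
        (fun y => a y * ENNReal.ofReal (f (barrier f r h s y))) x ≤
      ENNReal.ofReal (f (barrier f r h t x) * tailReal f (barrier f r h t x) *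
        (barrierConst r p α β K E * t ^ (1 - β - α / r))) := by
  have ht0 : 0 < t := ht.1
  have hp := hw.exponent_nonneg
  have hβ1 : β < 1 := (le_add_of_nonneg_left (by positivity)).trans_lt hpβ
  have hGt := le_toReal_heatOp ht0 hhξ (hdecay.heatOp_ne_top ht x)
  have hb := hw.pos.trans_le (hf.le_barrier hr hw.pos hGt)
  have hfb := hf.pos _ hb
  have hFb := hf.tailReal_pos hb
  set A := f (barrier f r h t x) * tailReal f (barrier f r h t x) with hA
  set B := A * ((2 * E) ^ (1 / r) * (2 * K)) * t ^ (β - α * (1 - p) / r) with hB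
  calc ∫⁻ s in Ioo 0 t, heatOp (t - s)
        (fun y => a y * ENNReal.ofReal (f (barrier f r h s y))) x
      ≤ ∫⁻ s in Ioo 0 t, ENNReal.ofReal B *
          ENNReal.ofReal (s ^ (-(α * p / r + β)) * (t - s) ^ (-β)) := by
        refine setLIntegral_mono' measurableSet_Ioo fun s hs => ?_
        have hs0 : 0 < s := hs.1
        have hts : 0 < t - s := sub_pos.2 hs.2
        refine (hw.heatOp_mul_apply_barrier_le hf hr ha hK hβ hadecay hh hhξ hE hdecay hs.1 hs.2
          ht.2 x).trans_eq ?_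
        rw [← hA, ← ENNReal.ofReal_mul (by positivity), hB, Real.div_rpow (by positivity) ht0.le,
          Real.mul_rpow hs0.le hts.le, neg_add, Real.rpow_add hs0, sub_eq_add_neg β,
          Real.rpow_add ht0, Real.rpow_neg ht0.le β, div_inv_eq_mul]
        ring_nf
    _ = _ := by
        have hpow : t ^ (1 - β - α / r) =
            t ^ (β - α * (1 - p) / r) * t ^ (1 - (α * p / r + β) - β) := by
          rw [← Real.rpow_add ht0]
          ring_nf
        rw [lintegral_const_mul' _ _ ENNReal.ofReal_ne_top,
          lintegral_rpow_mul_sub_rpow hpβ hβ1 ht0, ← ENNReal.ofReal_mul (by positivity), hB,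
          barrierConst, hpow]
        ring_nf

lemma heatOp_add_lintegral_le_barrier (hw : GrowthWindow f r p ξ) (hf : ClassS q f)
    (hr : 0 < r) (ha : Measurable a) (hK : 0 ≤ K) (hβ : 0 ≤ β)
    (hadecay : HeatDecayOn (Ioi 0) a K β) (hα : 0 ≤ α) (hpβ : α * p / r + β < 1)
    {u₀ : EuclideanSpace ℝ (Fin N) → ℝ} (hu₀ : Measurable u₀)
    (hh : h = fun y => shiftedNegPowF f r ξ (u₀ y)) (hE : 0 ≤ E)
    (hdecay : HeatDecayOn (Ioo 0 T) h E α) (ht : t ∈ Ioo 0 T)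
    (hsmall : barrierConst r p α β K E * t ^ (1 - β - α / r) ≤ 1 / (2 * r))
    (x : EuclideanSpace ℝ (Fin N)) :
    heatOp t (fun y => ENNReal.ofReal (u₀ y)) x + ∫⁻ s in Ioo 0 t, heatOp (t - s)
        (fun y => a y * ENNReal.ofReal (f (barrier f r h s y))) x ≤
      ENNReal.ofReal (barrier f r h t x) := by
  have hhm : Measurable h := hh ▸ (measurable_shiftedNegPowF f r ξ).comp hu₀
  have hhξ : ∀ y, ENNReal.ofReal (negPowF f r ξ) ≤ h y := fun y =>
    hh ▸ ofReal_negPowF_le_shiftedNegPowF f r ξ (u₀ y)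
  have hconv := hw.convexOn_negPowF hf hr.le
  have hfin := hdecay.heatOp_ne_top ht x
  have hG := le_toReal_heatOp ht.1 hhξ hfin
  set w₁ := negPowInv f r (heatOp t h x).toReal
  set w₂ := barrier f r h t x
  have hξw₁ : ξ ≤ w₁ := hf.le_negPowInv hr hw.pos hG
  have hξw₂ : ξ ≤ w₂ := hf.le_barrier hr hw.pos hG
  have hw₂pos := hw.pos.trans_le hξw₂
  have hfF := mul_pos (hf.pos w₂ hw₂pos) (hf.tailReal_pos hw₂pos)
  have hlinear : heatOp t (fun y => ENNReal.ofReal (u₀ y)) x ≤ ENNReal.ofReal w₁ :=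
    hf.heatOp_le_negPowInv hr hw.pos hconv ht.1 hG (hh ▸ (ENNReal.ofReal_toReal hfin).ge)
  have hgap : f w₂ * tailReal f w₂ / (2 * r) ≤ w₂ - w₁ :=
    hf.half_step_le_sub hr hw.pos hconv hξw₁ hξw₂ (by
      rw [hf.negPowF_barrier hr hw.pos hG, hf.negPowF_negPowInv hr hw.pos hG])
  have hduhamel : ∫⁻ s in Ioo 0 t, heatOp (t - s)
      (fun y => a y * ENNReal.ofReal (f (barrier f r h s y))) x ≤ ENNReal.ofReal (w₂ - w₁) := by
    refine (hw.lintegral_heatOp_mul_apply_barrier_le hf hr ha hK hβ hadecay hα hpβ hhm hhξ hE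
      hdecay ht x).trans (ENNReal.ofReal_le_ofReal (le_trans ?_ hgap))
    exact (mul_le_mul_of_nonneg_left hsmall hfF.le).trans_eq (mul_one_div _ _)
  refine (add_le_add hlinear hduhamel).trans_eq ?_
  rw [← ENNReal.ofReal_add (hw.pos.le.trans hξw₁) (le_trans (by positivity) hgap), add_sub_cancel]

end GrowthWindow

end Barrier

section Iteration

lemma exists_measurable_fixedPoint_le {α β : Type*} [MeasurableSpace α] [CompleteLinearOrder β]
    [TopologicalSpace β] [OrderTopology β] [SecondCountableTopology β] [MeasurableSpace β]
    [BorelSpace β] {Ψ : (α → β) → α → β} {W : α → β}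
    (hmeas : ∀ U, Measurable U → Measurable (Ψ U)) (hmono : MonotoneOn Ψ (Iic W))
    (hsup : ∀ U : ℕ → α → β, (∀ n, Measurable (U n)) → Monotone U → (∀ n, U n ≤ W) →
      Ψ (⨆ n, U n) = ⨆ n, Ψ (U n))
    (hW : Ψ W ≤ W) : ∃ U, Measurable U ∧ U ≤ W ∧ Ψ U = U := by
  set U : ℕ → α → β := fun n => Ψ^[n] ⊥
  have hsucc : ∀ n, U (n + 1) = Ψ (U n) := fun n => Function.iterate_succ_apply' Ψ n ⊥
  have hmeasU : ∀ n, Measurable (U n) := by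
    intro n
    induction n with
    | zero => exact measurable_const
    | succ n ih => exact hsucc n ▸ hmeas _ ih
  have hUW : ∀ n, U n ≤ W := by
    intro n
    induction n with
    | zero => exact bot_le
    | succ n ih => exact hsucc n ▸ (hmono ih self_mem_Iic ih).trans hW
  have hmonoU : Monotone U := by
    refine monotone_nat_of_le_succ fun n => ?_
    induction n with
    | zero => exact bot_le
    | succ n ih =>
      rw [hsucc n, hsucc (n + 1)]
      exact hmono (hUW n) (hUW (n + 1)) ih
  refine ⟨⨆ n, U n, ?_, iSup_le hUW, ?_⟩
  · have hpointwise : ⨆ n, U n = fun x => ⨆ n, U n x := funext fun _ => iSup_apply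
    exact hpointwise ▸ Measurable.iSup hmeasU
  · rw [hsup U hmeasU hmonoU hUW, ← hmonoU.iSup_nat_add 1]
    exact iSup_congr fun n => (hsucc n).symm

variable {N : ℕ} {f : ℝ → ℝ}

/-- The Duhamel integral `∫₀ᵗ e^{(t-s)Δ} g(s) ds` of a source term `g`, evaluated at
`(t, x) = p`. -/
noncomputable def duhamelOp (g : ℝ × EuclideanSpace ℝ (Fin N) → ℝ≥0∞)
    (p : ℝ × EuclideanSpace ℝ (Fin N)) : ℝ≥0∞ :=
  ∫⁻ s in Ioo 0 p.1, heatOp (p.1 - s) (fun y => g (s, y)) p.2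

lemma measurable_duhamelOp {g : ℝ × EuclideanSpace ℝ (Fin N) → ℝ≥0∞} (hg : Measurable g) :
    Measurable (duhamelOp g) := by
  have hindicator : ∀ p, duhamelOp g p = ∫⁻ s, {z : (ℝ × EuclideanSpace ℝ (Fin N)) × ℝ |
      z.2 ∈ Ioo 0 z.1.1}.indicator
        (fun z => heatOp (z.1.1 - z.2) (fun y => g (z.2, y)) z.1.2) (p, s) := by
    intro p
    rw [duhamelOp, ← lintegral_indicator measurableSet_Ioo]
    rfl
  rw [funext hindicator]
  refine Measurable.lintegral_prod_right' (Measurable.indicator ?_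
    ((measurableSet_lt measurable_const measurable_snd).inter
      (measurableSet_lt measurable_snd measurable_fst.fst)))
  refine Measurable.lintegral_prod_right' (f := fun z :
    ((ℝ × EuclideanSpace ℝ (Fin N)) × ℝ) × EuclideanSpace ℝ (Fin N) =>
      ENNReal.ofReal (heatKernel (z.1.1.1 - z.1.2) (z.1.1.2 - z.2)) * g (z.1.2, z.2)) ?_
  unfold heatKernel
  fun_prop

lemma duhamelOp_mono {g g' : ℝ × EuclideanSpace ℝ (Fin N) → ℝ≥0∞} (h : g ≤ g') :
    duhamelOp g ≤ duhamelOp g' := fun _ =>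
  lintegral_mono fun _ => heatOp_mono _ (fun _ => h _) _

lemma heatOp_iSup (t : ℝ) {φ : ℕ → EuclideanSpace ℝ (Fin N) → ℝ≥0∞}
    (hφ : ∀ n, Measurable (φ n)) (hmono : Monotone φ) :
    heatOp t (⨆ n, φ n) = ⨆ n, heatOp t (φ n) := by
  ext x
  simp_rw [iSup_apply, heatOp, iSup_apply, ENNReal.mul_iSup]
  exact lintegral_iSup (fun n => (measurable_heatKernel_sub t x).mul (hφ n))
    fun n m hnm y => mul_le_mul_right (hmono hnm y) _

lemma duhamelOp_iSup {g : ℕ → ℝ × EuclideanSpace ℝ (Fin N) → ℝ≥0∞}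
    (hg : ∀ n, Measurable (g n)) (hmono : Monotone g) :
    duhamelOp (⨆ n, g n) = ⨆ n, duhamelOp (g n) := by
  ext ⟨t, x⟩
  have hinner : ∀ s, heatOp (t - s) (fun y => (⨆ n, g n) (s, y)) x =
      ⨆ n, heatOp (t - s) (fun y => g n (s, y)) x := by
    intro s
    have h := congrFun (heatOp_iSup (t - s) (φ := fun n y => g n (s, y))
      (fun n => (hg n).comp measurable_prodMk_left) fun n m hnm y => hmono hnm (s, y)) x
    rw [iSup_apply] at h
    rw [← h]
    congr 1
    exact funext fun y => by rw [iSup_apply, iSup_apply]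
  simp_rw [iSup_apply, duhamelOp, hinner]
  refine lintegral_iSup (fun n => ?_)
    fun n m hnm s => heatOp_mono _ (fun y => hmono hnm (s, y)) x
  refine Measurable.lintegral_prod_right' (f := fun z : ℝ × EuclideanSpace ℝ (Fin N) =>
    ENNReal.ofReal (heatKernel (t - z.1) (x - z.2)) * g n z) ?_
  have := hg n
  unfold heatKernel
  fun_prop

lemma measurable_ofReal_apply_toReal (hcont : ContinuousOn f (Ici 0)) :
    Measurable fun v : ℝ≥0∞ => ENNReal.ofReal (f v.toReal) := by
  have hmax : Continuous fun v : ℝ => f (max v 0) :=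
    hcont.comp_continuous (by fun_prop) fun v => le_max_right v 0
  have heq : (fun v : ℝ≥0∞ => ENNReal.ofReal (f v.toReal)) =
      fun v => ENNReal.ofReal (f (max v.toReal 0)) := by
    simp only [max_eq_left ENNReal.toReal_nonneg]
  rw [heq]
  exact (hmax.measurable.comp ENNReal.measurable_toReal).ennreal_ofReal

lemma monotoneOn_ofReal_apply_toReal (hmono : MonotoneOn f (Ici 0)) :
    MonotoneOn (fun v : ℝ≥0∞ => ENNReal.ofReal (f v.toReal)) (Iio ∞) := fun _ _ _ hv huv =>
  ENNReal.ofReal_le_ofReal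
    (hmono ENNReal.toReal_nonneg ENNReal.toReal_nonneg (ENNReal.toReal_mono (ne_of_lt hv) huv))

lemma ofReal_apply_toReal_iSup (hcont : ContinuousOn f (Ici 0)) (hmono : MonotoneOn f (Ici 0))
    {v : ℕ → ℝ≥0∞} (hv : Monotone v) (htop : ⨆ n, v n < ∞) :
    ENNReal.ofReal (f (⨆ n, v n).toReal) = ⨆ n, ENNReal.ofReal (f (v n).toReal) := by
  have hvtop : ∀ n, v n < ∞ := fun n => (le_iSup v n).trans_lt htop
  have hlim : Tendsto (fun n => (v n).toReal) atTop (𝓝[Ici 0] (⨆ n, v n).toReal) :=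
    tendsto_nhdsWithin_iff.2 ⟨(ENNReal.tendsto_toReal htop.ne).comp (tendsto_atTop_iSup hv),
      Eventually.of_forall fun n => ENNReal.toReal_nonneg⟩
  refine tendsto_nhds_unique
    (ENNReal.tendsto_ofReal ((hcont _ ENNReal.toReal_nonneg).tendsto.comp hlim))
    (tendsto_atTop_iSup fun m n hmn => ?_)
  exact monotoneOn_ofReal_apply_toReal hmono (hvtop m) (hvtop n) (hv hmn)

/-- The source `a · f(U)` of a semilinear heat equation, for `[0, ∞]`-valued `U`. It is meant for
finite `U` only: the conversion to `ℝ` sends `∞` to `0`. -/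
noncomputable def semilinearSource (a : ℝ × EuclideanSpace ℝ (Fin N) → ℝ≥0∞) (f : ℝ → ℝ)
    (U : ℝ × EuclideanSpace ℝ (Fin N) → ℝ≥0∞) (z : ℝ × EuclideanSpace ℝ (Fin N)) : ℝ≥0∞ :=
  a z * ENNReal.ofReal (f (U z).toReal)

variable {a : ℝ × EuclideanSpace ℝ (Fin N) → ℝ≥0∞}

lemma measurable_semilinearSource (hcont : ContinuousOn f (Ici 0)) (ha : Measurable a)
    {U : ℝ × EuclideanSpace ℝ (Fin N) → ℝ≥0∞} (hU : Measurable U) :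
    Measurable (semilinearSource a f U) :=
  ha.fun_mul ((measurable_ofReal_apply_toReal hcont).comp hU)

lemma semilinearSource_mono (hmono : MonotoneOn f (Ici 0))
    {U V : ℝ × EuclideanSpace ℝ (Fin N) → ℝ≥0∞} (hUV : U ≤ V) (hV : ∀ z, V z < ∞) :
    semilinearSource a f U ≤ semilinearSource a f V := fun z => mul_le_mul_right
  (monotoneOn_ofReal_apply_toReal hmono ((hUV z).trans_lt (hV z)) (hV z) (hUV z)) _

lemma semilinearSource_iSup (hcont : ContinuousOn f (Ici 0)) (hmono : MonotoneOn f (Ici 0))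
    {U : ℕ → ℝ × EuclideanSpace ℝ (Fin N) → ℝ≥0∞} (hU : Monotone U)
    (htop : ∀ z, (⨆ n, U n) z < ∞) :
    semilinearSource a f (⨆ n, U n) = ⨆ n, semilinearSource a f (U n) := by
  ext z
  have htopz := htop z
  simp only [iSup_apply] at htopz
  simp only [semilinearSource, iSup_apply]
  rw [ofReal_apply_toReal_iSup hcont hmono (fun n m hnm => hU hnm z) htopz, ENNReal.mul_iSup]

/-- The right-hand side `v + ∫₀ᵗ e^{(t-s)Δ} a f(U(s)) ds` of Duhamel's formula on the set `S` of
space-time, extended by zero. -/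
noncomputable def duhamelMap (S : Set (ℝ × EuclideanSpace ℝ (Fin N)))
    (a v : ℝ × EuclideanSpace ℝ (Fin N) → ℝ≥0∞) (f : ℝ → ℝ)
    (U : ℝ × EuclideanSpace ℝ (Fin N) → ℝ≥0∞) : ℝ × EuclideanSpace ℝ (Fin N) → ℝ≥0∞ :=
  S.indicator (v + duhamelOp (semilinearSource a f U))

lemma duhamelMap_mono (hmono : MonotoneOn f (Ici 0))
    (S : Set (ℝ × EuclideanSpace ℝ (Fin N))) (v : ℝ × EuclideanSpace ℝ (Fin N) → ℝ≥0∞)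
    {U V : ℝ × EuclideanSpace ℝ (Fin N) → ℝ≥0∞} (hUV : U ≤ V) (hV : ∀ z, V z < ∞) :
    duhamelMap S a v f U ≤ duhamelMap S a v f V :=
  indicator_mono (add_le_add_right (duhamelOp_mono (semilinearSource_mono hmono hUV hV)) v)

lemma duhamelMap_iSup (hcont : ContinuousOn f (Ici 0)) (hmono : MonotoneOn f (Ici 0))
    (ha : Measurable a) (S : Set (ℝ × EuclideanSpace ℝ (Fin N)))
    (v : ℝ × EuclideanSpace ℝ (Fin N) → ℝ≥0∞)
    {U : ℕ → ℝ × EuclideanSpace ℝ (Fin N) → ℝ≥0∞} (hU : ∀ n, Measurable (U n))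
    (hUmono : Monotone U) (htop : ∀ z, (⨆ n, U n) z < ∞) :
    duhamelMap S a v f (⨆ n, U n) = ⨆ n, duhamelMap S a v f (U n) := by
  have hsource : Monotone fun n => semilinearSource a f (U n) := fun n m hnm =>
    semilinearSource_mono hmono (hUmono hnm) fun z => (le_iSup U m z).trans_lt (htop z)
  ext p
  simp only [duhamelMap, semilinearSource_iSup hcont hmono hUmono htop, iSup_apply,
    duhamelOp_iSup (fun n => measurable_semilinearSource hcont ha (hU n)) hsource]
  by_cases hp : p ∈ S
  · simp only [indicator_of_mem hp, Pi.add_apply, iSup_apply, ENNReal.add_iSup]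
  · simp only [indicator_of_notMem hp, iSup_const]

theorem exists_duhamel_solution_le (hcont : ContinuousOn f (Ici 0)) (hmono : MonotoneOn f (Ici 0))
    (ha : Measurable a) {v : ℝ × EuclideanSpace ℝ (Fin N) → ℝ≥0∞} (hv : Measurable v)
    {S : Set (ℝ × EuclideanSpace ℝ (Fin N))} (hS : MeasurableSet S)
    {w : ℝ × EuclideanSpace ℝ (Fin N) → ℝ} (hw0 : 0 ≤ w)
    (hw : ∀ p ∈ S, v p + duhamelOp (fun z => a z * ENNReal.ofReal (f (w z))) p ≤
      ENNReal.ofReal (w p)) :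
    ∃ u : ℝ × EuclideanSpace ℝ (Fin N) → ℝ, Measurable u ∧ 0 ≤ u ∧ u ≤ w ∧ ∀ p ∈ S,
      ENNReal.ofReal (u p) = v p + duhamelOp (fun z => a z * ENNReal.ofReal (f (u z))) p := by
  set W : ℝ × EuclideanSpace ℝ (Fin N) → ℝ≥0∞ := fun p => ENNReal.ofReal (w p) with hW
  have hlt : ∀ {U : ℝ × EuclideanSpace ℝ (Fin N) → ℝ≥0∞}, U ≤ W → ∀ p, U p < ∞ :=
    fun hU p => (hU p).trans_lt ENNReal.ofReal_lt_top
  have hsuper : duhamelMap S a v f W ≤ W := indicator_le fun p hp => by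
    have hsource : semilinearSource a f W = fun z => a z * ENNReal.ofReal (f (w z)) := by
      simp only [funext_iff, semilinearSource, hW, ENNReal.toReal_ofReal (hw0 _), implies_true]
    rw [hsource]
    exact hw p hp
  obtain ⟨U, hU, hUW, hfix⟩ := exists_measurable_fixedPoint_le
    (fun U hU => (hv.add (measurable_duhamelOp
      (measurable_semilinearSource hcont ha hU))).indicator hS)
    (fun U _ V hV hUV => duhamelMap_mono hmono S v hUV (hlt hV))
    (fun U hU hUmono hUW => duhamelMap_iSup hcont hmono ha S v hU hUmono (hlt (iSup_le hUW)))
    hsuper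
  refine ⟨fun p => (U p).toReal, hU.ennreal_toReal, fun p => ENNReal.toReal_nonneg,
    fun p => ENNReal.toReal_le_of_le_ofReal (hw0 p) (hUW p), fun p hp => ?_⟩
  have hfixp : v p + duhamelOp (semilinearSource a f U) p = U p := by
    rw [← congrFun hfix p]
    exact (indicator_of_mem hp (v + duhamelOp (semilinearSource a f U))).symm
  rw [ENNReal.ofReal_toReal (hlt hUW p).ne, ← hfixp]
  rfl

end Iteration

section Existence

variable {N : ℕ} {q r p ξ γ E K T : ℝ} {f : ℝ → ℝ}

lemma exists_forall_mul_rpow_le {κ ε : ℝ} (hκ : 0 < κ) (c : ℝ) (hε : 0 < ε) :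
    ∃ T : ℝ, 0 < T ∧ T ≤ 1 ∧ ∀ t ∈ Ioo 0 T, c * t ^ κ ≤ ε := by
  have hlim : Tendsto (fun t : ℝ => c * t ^ κ) (𝓝 0) (𝓝 0) := by
    have hcont := (Real.continuousAt_rpow_const 0 κ (Or.inr hκ.le)).const_mul c
    simpa only [ContinuousAt, Real.zero_rpow hκ.ne', mul_zero] using hcont
  obtain ⟨η, hη, hsmall⟩ := Metric.eventually_nhds_iff.1 (hlim.eventually_le_const hε)
  refine ⟨min η 1, lt_min hη one_pos, min_le_right _ _, fun t ht => hsmall ?_⟩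
  rw [Real.dist_0_eq_abs, abs_of_pos ht.1]
  exact ht.2.trans_le (min_le_left _ _)

lemma exists_heatDecayOn_of_ulMass_lt_top {φ : EuclideanSpace ℝ (Fin N) → ℝ≥0∞}
    (hφ : AEMeasurable φ) (hmass : ulMass φ < ∞) :
    ∃ E : ℝ, 0 ≤ E ∧ HeatDecayOn (Ioc 0 1) φ E (N / 2) := by
  obtain ⟨C, hC, hdecay⟩ := exists_heatDecayOn_of_ulMass_le N
  exact ⟨C * (ulMass φ).toNNReal, by positivity,
    hdecay φ _ hφ (ENNReal.coe_toNNReal hmass.ne).ge⟩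

/-- The bounded part of `φ` contributes `O(1) = o(t^{-N/2})`, so only the small part counts. -/
lemma exists_heatDecayOn_of_le_const_add (hN : 1 ≤ N) {φ : EuclideanSpace ℝ (Fin N) → ℝ≥0∞}
    (happrox : ∀ ε : ℝ≥0, 0 < ε → ∃ (M : ℝ≥0) (ψ : EuclideanSpace ℝ (Fin N) → ℝ≥0∞),
      AEMeasurable ψ ∧ ulMass ψ ≤ ε ∧ ∀ x, φ x ≤ M + ψ x) (hE : 0 < E) :
    ∃ T : ℝ, 0 < T ∧ T ≤ 1 ∧ HeatDecayOn (Ioo 0 T) φ E (N / 2) := by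
  obtain ⟨C, hC, hdecay⟩ := exists_heatDecayOn_of_ulMass_le N
  obtain ⟨M, ψ, hψ, hmass, hφ⟩ := happrox (E / (2 * C)).toNNReal (by positivity)
  have hN2 : (0 : ℝ) < N / 2 := by positivity
  obtain ⟨T, hT, hT1, hsmall⟩ := exists_forall_mul_rpow_le hN2 M (half_pos hE)
  refine ⟨T, hT, hT1, fun t ht x => ?_⟩
  have ht0 : 0 < t := ht.1
  have hM : (M : ℝ) ≤ E / 2 * t ^ (-(N / 2 : ℝ)) := by
    rw [Real.rpow_neg ht0.le, ← div_eq_mul_inv, le_div_iff₀ (by positivity)]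
    exact hsmall t ht
  calc heatOp t φ x ≤ M + heatOp t ψ x := (heatOp_mono t hφ x).trans_eq (heatOp_const_add ht0 ..)
    _ ≤ ENNReal.ofReal (E / 2 * t ^ (-(N / 2 : ℝ))) +
        ENNReal.ofReal (E / 2 * t ^ (-(N / 2 : ℝ))) := by
      have hψt := hdecay ψ _ hψ hmass t ⟨ht0, ht.2.le.trans hT1⟩ x
      rw [Real.coe_toNNReal _ (by positivity), ← mul_div_assoc,
        mul_comm 2 C, mul_div_mul_left _ _ hC.ne'] at hψt
      exact add_le_add (ENNReal.le_ofReal_iff_toReal_le ENNReal.coe_ne_top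
        (by positivity) |>.2 hM) hψt
    _ = ENNReal.ofReal (E * t ^ (-(N / 2 : ℝ))) := by
      rw [← ENNReal.ofReal_add (by positivity) (by positivity), ← add_mul, add_halves]

lemma MemULClosure.exists_le_const_add {φ : EuclideanSpace ℝ (Fin N) → ℝ} (hφ : MemULClosure φ)
    {ε : ℝ≥0} (hε : 0 < ε) : ∃ (M : ℝ≥0) (ψ : EuclideanSpace ℝ (Fin N) → ℝ≥0∞),
      AEMeasurable ψ ∧ ulMass ψ ≤ ε ∧ ∀ x, ENNReal.ofReal (φ x) ≤ M + ψ x := by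
  obtain ⟨g, hg, ⟨M, hM⟩, hgε⟩ := hφ.2 ε (by exact_mod_cast hε)
  have hM0 : 0 ≤ M := (abs_nonneg _).trans (hM 0)
  refine ⟨M.toNNReal, fun x => ‖φ x - g x‖ₑ,
    (hφ.1.1.aemeasurable.sub hg.continuous.measurable.aemeasurable).enorm, hgε.le, fun x => ?_⟩
  calc ENNReal.ofReal (φ x) ≤ ENNReal.ofReal (M + |φ x - g x|) := ENNReal.ofReal_le_ofReal (by
        linarith [le_abs_self (φ x - g x), le_abs_self (g x), hM x])
    _ = ENNReal.ofReal M + ‖φ x - g x‖ₑ := by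
        rw [ENNReal.ofReal_add hM0 (abs_nonneg _), Real.enorm_eq_ofReal_abs]

lemma ulMass_shiftedNegPowF_lt_top (f : ℝ → ℝ) (r ξ : ℝ) {u₀ : EuclideanSpace ℝ (Fin N) → ℝ}
    (hu₀ : ulNorm (fun x => negPowF f r (u₀ x)) < ∞) :
    ulMass (fun x => shiftedNegPowF f r ξ (u₀ x)) < ∞ := by
  refine (ulMass_add_le measurable_const _).trans_lt (ENNReal.add_lt_top.2 ⟨?_, ?_⟩)
  · rw [ulMass_const]
    exact ENNReal.mul_lt_top ENNReal.ofReal_lt_top measure_ball_lt_top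
  · exact (ulMass_mono fun x => Real.ofReal_le_enorm _).trans_lt hu₀

lemma ClassS.aemeasurable_of_negPowF (hf : ClassS q f) (hr : 0 < r)
    {u₀ : EuclideanSpace ℝ (Fin N) → ℝ} (hu₀ : ∀ x, 0 ≤ u₀ x)
    (hG : AEMeasurable fun x => negPowF f r (u₀ x)) : AEMeasurable u₀ :=
  ((hf.negPowInv_monotone hr).measurable.comp_aemeasurable hG).congr
    (ae_of_all _ fun x => hf.negPowInv_negPowF hr (hu₀ x))

lemma ulNorm_le_of_le_heatOp {h : EuclideanSpace ℝ (Fin N) → ℝ≥0∞}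
    {ψ : EuclideanSpace ℝ (Fin N) → ℝ} {t c d : ℝ} (ht : 0 < t) (hh : Measurable h)
    (hψ : ∀ x, 0 ≤ ψ x) (hd : 0 ≤ d) (hle : ∀ x, ψ x ≤ c + d * (heatOp t h x).toReal) :
    ulNorm ψ ≤ ENNReal.ofReal c * volume (Metric.ball (0 : EuclideanSpace ℝ (Fin N)) 1) +
      ENNReal.ofReal d * ulMass h := by
  have hpoint : ∀ x, ‖ψ x‖ₑ ≤ ENNReal.ofReal c + ENNReal.ofReal d * heatOp t h x := by
    intro x
    rw [Real.enorm_of_nonneg (hψ x)]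
    refine (ENNReal.ofReal_le_ofReal (hle x)).trans (ENNReal.ofReal_add_le.trans ?_)
    rw [ENNReal.ofReal_mul hd]
    gcongr
    exact ENNReal.ofReal_toReal_le
  have hheat : Measurable (heatOp t h) := (measurable_heatOp hh).comp measurable_prodMk_left
  rw [ulNorm_eq_ulMass]
  refine (ulMass_mono hpoint).trans ((ulMass_add_le measurable_const _).trans ?_)
  rw [ulMass_const, ulMass_const_mul _ hheat]
  gcongr
  exact ulMass_heatOp_le ht hh

lemma heatEvol_norm_rpow_mul (t γ : ℝ) (g : EuclideanSpace ℝ (Fin N) → ℝ) :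
    heatEvol t (fun y => ‖y‖ ^ (-γ) * g y) =
      heatOp t fun y => ENNReal.ofReal (‖y‖ ^ (-γ)) * ENNReal.ofReal (g y) := by
  simp_rw [heatEvol_eq_heatOp, ENNReal.ofReal_mul (Real.rpow_nonneg (norm_nonneg _) _)]

lemma IsLocalSolution.of_le_heatOp {u : ℝ → EuclideanSpace ℝ (Fin N) → ℝ}
    {u₀ : EuclideanSpace ℝ (Fin N) → ℝ} {h : EuclideanSpace ℝ (Fin N) → ℝ≥0∞} {α c d : ℝ}
    (hum : Measurable (Function.uncurry u)) (hu0 : ∀ t x, 0 ≤ u t x) (hh : Measurable h)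
    (hmass : ulMass h < ∞) (hE : 0 ≤ E) (hα : 0 ≤ α) (hdecay : HeatDecayOn (Ioo 0 T) h E α)
    (hd : 0 ≤ d) (hle : ∀ t ∈ Ioo 0 T, ∀ x, u t x ≤ c + d * (heatOp t h x).toReal)
    (hduhamel : ∀ t ∈ Ioo 0 T, ∀ x, ENNReal.ofReal (u t x) = heatEvol t u₀ x +
      ∫⁻ s in Ioo 0 t, heatEvol (t - s) (fun y => ‖y‖ ^ (-γ) * f (u s y)) x) :
    IsLocalSolution γ f u₀ T u where
  measurable := hum.aemeasurable
  nonneg t _ x := hu0 t x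
  bounded_ul := by
    set B := ENNReal.ofReal c * volume (Metric.ball (0 : EuclideanSpace ℝ (Fin N)) 1) +
      ENNReal.ofReal d * ulMass h
    have hB : B < ∞ := ENNReal.add_lt_top.2
      ⟨ENNReal.mul_lt_top ENNReal.ofReal_lt_top measure_ball_lt_top,
        ENNReal.mul_lt_top ENNReal.ofReal_lt_top hmass⟩
    refine ⟨B.toNNReal, (ae_restrict_iff' measurableSet_Ioo).2 (ae_of_all _ fun t ht => ?_)⟩
    have hul : ulNorm (u t) ≤ B := ulNorm_le_of_le_heatOp ht.1 hh (hu0 t) hd (hle t ht)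
    rw [ENNReal.coe_toNNReal hB.ne]
    exact ⟨⟨(hum.comp measurable_prodMk_left).aestronglyMeasurable, hul.trans_lt hB⟩, hul⟩
  locally_bounded a b ha hb := by
    refine ⟨(c + d * (E * a ^ (-α))).toNNReal,
      (ae_restrict_iff' measurableSet_Icc).2 (ae_of_all _ fun t ht => ?_)⟩
    have ht0 : 0 < t := ha.trans_le ht.1
    have htT : t ∈ Ioo 0 T := ⟨ht0, ht.2.trans_lt hb⟩
    rw [eLpNorm_exponent_top]
    refine eLpNormEssSup_le_of_ae_bound (ae_of_all _ fun x => ?_)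
    rw [Real.norm_of_nonneg (hu0 t x)]
    refine (hle t htT x).trans (add_le_add_right (mul_le_mul_of_nonneg_left
      ((hdecay.toReal_heatOp_le hE ht0.le htT x).trans (mul_le_mul_of_nonneg_left ?_ hE)) hd) c)
    exact Real.rpow_le_rpow_of_nonpos ha ht.1 (neg_nonpos.2 hα)
  duhamel t ht := ae_of_all _ (hduhamel t ht)

/-- Existence of a local-in-time solution `u` along which the uniformly local norm of
`F(u)^{-r}` is bounded by `C`: the conclusion of the existence theorem. -/
def HasBoundedLocalSolution (γ : ℝ) (f : ℝ → ℝ) (r : ℝ) (u₀ : EuclideanSpace ℝ (Fin N) → ℝ)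
    (C : ℝ≥0∞) : Prop :=
  ∃ T : ℝ, 0 < T ∧ ∃ u : ℝ → EuclideanSpace ℝ (Fin N) → ℝ, IsLocalSolution γ f u₀ T u ∧
    ∀ t ∈ Ioo 0 T, MemUL (fun x => negPowF f r (u t x)) ∧
      ulNorm (fun x => negPowF f r (u t x)) ≤ C

namespace HasBoundedLocalSolution

variable {u₀ v₀ : EuclideanSpace ℝ (Fin N) → ℝ} {C C' : ℝ≥0∞}

lemma mono (hu₀ : HasBoundedLocalSolution γ f r u₀ C) (hC : C ≤ C') :
    HasBoundedLocalSolution γ f r u₀ C' := by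
  obtain ⟨T, hT, u, hu, hbound⟩ := hu₀
  exact ⟨T, hT, u, hu, fun t ht => ⟨(hbound t ht).1, (hbound t ht).2.trans hC⟩⟩

lemma congr_ae (hu₀ : HasBoundedLocalSolution γ f r u₀ C) (h : u₀ =ᵐ[volume] v₀) :
    HasBoundedLocalSolution γ f r v₀ C := by
  obtain ⟨T, hT, u, hu, hbound⟩ := hu₀
  refine ⟨T, hT, u, { hu with duhamel := fun t ht => ?_ }, hbound⟩
  have hinit : heatEvol t u₀ = heatEvol t v₀ :=
    heatOp_congr_ae t (h.fun_comp ENNReal.ofReal)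
  rw [← hinit]
  exact hu.duhamel t ht

end HasBoundedLocalSolution

namespace GrowthWindow

lemma exists_barrier_le (hw : GrowthWindow f r p ξ) (hf : ClassS q f) (hr : 0 < r) :
    ∃ D : ℝ, 0 ≤ D ∧ ∀ (h : EuclideanSpace ℝ (Fin N) → ℝ≥0∞) (t : ℝ)
      (x : EuclideanSpace ℝ (Fin N)), negPowF f r ξ ≤ (heatOp t h x).toReal →
        barrier f r h t x ≤ ξ + D * (heatOp t h x).toReal := by
  have hfF := mul_pos (hf.pos ξ hw.pos) (hf.tailReal_pos hw.pos)
  have hG := hf.negPowF_pos r hw.pos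
  refine ⟨f ξ * tailReal f ξ / (r * negPowF f r ξ) * 2, by positivity, fun h t x hle => ?_⟩
  have htangent := hf.le_tangent_negPowF hr hw.pos (hw.convexOn_negPowF hf hr.le) le_rfl
    (hf.le_barrier hr hw.pos hle)
  rw [hf.negPowF_barrier hr hw.pos hle, ← mul_assoc] at htangent
  linarith [div_pos hfF hr]

lemma hasBoundedLocalSolution_of_measurable (hw : GrowthWindow f r p ξ) (hf : ClassS q f)
    (hr : 0 < r) (hγ : 0 ≤ γ) (hK : 0 ≤ K)
    (hsing : HeatDecayOn (Ioi 0)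
      (fun y : EuclideanSpace ℝ (Fin N) => ENNReal.ofReal (‖y‖ ^ (-γ))) K (γ / 2))
    (hp : N / 2 * p / r + γ / 2 < 1) {u₀ : EuclideanSpace ℝ (Fin N) → ℝ} (hu₀ : Measurable u₀)
    (hmass : ulMass (fun x => shiftedNegPowF f r ξ (u₀ x)) < ∞) (hE : 0 ≤ E)
    (hdecay : HeatDecayOn (Ioo 0 T) (fun x => shiftedNegPowF f r ξ (u₀ x)) E (N / 2))
    (hT : 0 < T) (hsmall : ∀ t ∈ Ioo 0 T,
      barrierConst r p (N / 2) (γ / 2) K E * t ^ (1 - γ / 2 - N / 2 / r) ≤ 1 / (2 * r)) :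
    HasBoundedLocalSolution γ f r u₀ (2 * ulMass fun x => shiftedNegPowF f r ξ (u₀ x)) := by
  set h := fun x => shiftedNegPowF f r ξ (u₀ x) with hh
  have hhm : Measurable h := (measurable_shiftedNegPowF f r ξ).comp hu₀
  have hN2 : (0 : ℝ) ≤ N / 2 := by positivity
  have ha : Measurable fun y : EuclideanSpace ℝ (Fin N) => ENNReal.ofReal (‖y‖ ^ (-γ)) := by
    fun_prop
  obtain ⟨U, hUm, hU0, hUw, hU⟩ := exists_duhamel_solution_le hf.continuousOn hf.monotoneOn
    (a := fun z => ENNReal.ofReal (‖z.2‖ ^ (-γ))) (by fun_prop)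
    (measurable_heatOp hu₀.ennreal_ofReal) (measurableSet_Ioo.prod MeasurableSet.univ)
    (w := fun z => barrier f r h z.1 z.2) (fun z => barrier_nonneg f r h z.1 z.2)
    (fun z hz => hw.heatOp_add_lintegral_le_barrier hf hr ha hK (by positivity) hsing hN2 hp hu₀
      hh hE hdecay hz.1 (hsmall z.1 hz.1) z.2)
  have hGh : ∀ t ∈ Ioo 0 T, ∀ x, negPowF f r ξ ≤ (heatOp t h x).toReal := fun t ht x =>
    le_toReal_heatOp ht.1 (fun y => ofReal_negPowF_le_shiftedNegPowF f r ξ (u₀ y))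
      (hdecay.heatOp_ne_top ht x)
  obtain ⟨D, hD, hbarrier⟩ := hw.exists_barrier_le (N := N) hf hr
  refine ⟨T, hT, fun t x => U (t, x), .of_le_heatOp hUm (fun t x => hU0 (t, x)) hhm hmass hE hN2
    hdecay hD (fun t ht x => (hUw (t, x)).trans (hbarrier h t x (hGh t ht x))) ?_, ?_⟩
  · intro t ht x
    simp_rw [heatEvol_norm_rpow_mul]
    exact hU (t, x) ⟨ht, mem_univ x⟩
  · intro t ht
    have hG : ∀ x, negPowF f r (U (t, x)) ≤ 0 + 2 * (heatOp t h x).toReal := fun x => by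
      rw [zero_add, ← hf.negPowF_barrier hr hw.pos (hGh t ht x)]
      exact (hf.negPowF_strictMonoOn hr).monotoneOn (hU0 (t, x)) (barrier_nonneg f r h t x)
        (hUw (t, x))
    have hul := ulNorm_le_of_le_heatOp ht.1 hhm (fun x => negPowF_nonneg f r _) zero_le_two hG
    rw [ENNReal.ofReal_zero, zero_mul, zero_add, ENNReal.ofReal_ofNat] at hul
    exact ⟨⟨((measurable_negPowF f r).comp (hUm.comp measurable_prodMk_left)).aestronglyMeasurable,
      hul.trans_lt (ENNReal.mul_lt_top (by simp) hmass)⟩, hul⟩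

lemma hasBoundedLocalSolution (hw : GrowthWindow f r p ξ) (hf : ClassS q f)
    (hr : 0 < r) (hγ : 0 ≤ γ) (hK : 0 ≤ K)
    (hsing : HeatDecayOn (Ioi 0)
      (fun y : EuclideanSpace ℝ (Fin N) => ENNReal.ofReal (‖y‖ ^ (-γ))) K (γ / 2))
    (hp : N / 2 * p / r + γ / 2 < 1) {u₀ : EuclideanSpace ℝ (Fin N) → ℝ} (hu₀ : AEMeasurable u₀)
    (hmass : ulMass (fun x => shiftedNegPowF f r ξ (u₀ x)) < ∞) (hE : 0 ≤ E)
    (hdecay : HeatDecayOn (Ioo 0 T) (fun x => shiftedNegPowF f r ξ (u₀ x)) E (N / 2))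
    (hT : 0 < T) (hsmall : ∀ t ∈ Ioo 0 T,
      barrierConst r p (N / 2) (γ / 2) K E * t ^ (1 - γ / 2 - N / 2 / r) ≤ 1 / (2 * r)) :
    HasBoundedLocalSolution γ f r u₀ (2 * ulMass fun x => shiftedNegPowF f r ξ (u₀ x)) := by
  have hh : (fun x => shiftedNegPowF f r ξ (u₀ x)) =ᵐ[volume]
      fun x => shiftedNegPowF f r ξ (hu₀.mk u₀ x) :=
    hu₀.ae_eq_mk.fun_comp (shiftedNegPowF f r ξ)
  have hdecay' : HeatDecayOn (Ioo 0 T) (fun x => shiftedNegPowF f r ξ (hu₀.mk u₀ x)) E (N / 2) :=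
    fun t ht x => heatOp_congr_ae t hh ▸ hdecay t ht x
  rw [ulMass_congr_ae hh] at hmass ⊢
  exact (hw.hasBoundedLocalSolution_of_measurable hf hr hγ hK hsing hp hu₀.measurable_mk hmass hE
    hdecay' hT hsmall).congr_ae hu₀.ae_eq_mk.symm

lemma hasBoundedLocalSolution_of_lt (hw : GrowthWindow f r p ξ) (hf : ClassS q f) (hN : 1 ≤ N)
    (hr : 0 < r) (hγ : 0 ≤ γ) (hγ' : γ < min 2 (N : ℝ)) (hγr : (N : ℝ) / (2 - γ) < r)
    {u₀ : EuclideanSpace ℝ (Fin N) → ℝ} (hu₀ : AEMeasurable u₀)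
    (hmass : ulMass (fun x => shiftedNegPowF f r ξ (u₀ x)) < ∞) :
    HasBoundedLocalSolution γ f r u₀ (2 * ulMass fun x => shiftedNegPowF f r ξ (u₀ x)) := by
  obtain ⟨hγ2, hγN⟩ := lt_min_iff.1 hγ'
  obtain ⟨K, hK, hsing⟩ := exists_heatDecayOn_norm_rpow hN hγ hγN
  obtain ⟨E, hE, hdecay⟩ := exists_heatDecayOn_of_ulMass_lt_top
    ((measurable_shiftedNegPowF f r ξ).comp_aemeasurable hu₀) hmass
  have hexp : N / 2 / r < 1 - γ / 2 := by
    rw [div_lt_iff₀ (sub_pos.2 hγ2)] at hγr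
    rw [div_lt_iff₀ hr]
    linarith
  have hp : N / 2 * p / r ≤ N / 2 / r :=
    div_le_div_of_nonneg_right (mul_le_of_le_one_right (by positivity) hw.exponent_le_one) hr.le
  obtain ⟨T, hT, hT1, hsmall⟩ := exists_forall_mul_rpow_le (sub_pos.2 hexp)
    (barrierConst r p (N / 2) (γ / 2) K E) (ε := 1 / (2 * r)) (by positivity)
  exact hw.hasBoundedLocalSolution hf hr hγ hK hsing (by linarith) hu₀ hmass hE
    (hdecay.mono fun t ht => ⟨ht.1, ht.2.le.trans hT1⟩) hT hsmall

/-- At the critical exponent the power of `t` in the smallness condition is `t^0`, so smallness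
has to come from the constant `E` in the decay of the data. -/
lemma hasBoundedLocalSolution_of_eq (hw : GrowthWindow f r p ξ) (hf : ClassS q f) (hN : 1 ≤ N)
    (hr : 0 < r) (hγ : 0 ≤ γ) (hγ' : γ < min 2 (N : ℝ)) (hγr : r = N / (2 - γ)) (hp : p < 1)
    {u₀ : EuclideanSpace ℝ (Fin N) → ℝ} (hu₀ : AEMeasurable u₀)
    (hcl : MemULClosure fun x => negPowF f r (u₀ x)) :
    HasBoundedLocalSolution γ f r u₀ (2 * ulMass fun x => shiftedNegPowF f r ξ (u₀ x)) := by
  obtain ⟨hγ2, hγN⟩ := lt_min_iff.1 hγ'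
  obtain ⟨K, hK, hsing⟩ := exists_heatDecayOn_norm_rpow hN hγ hγN
  have hexp : N / 2 / r = 1 - γ / 2 := by
    rw [eq_div_iff (sub_pos.2 hγ2).ne'] at hγr
    rw [div_eq_iff hr.ne']
    linarith
  have hpr : N / 2 * p / r < N / 2 / r :=
    div_lt_div_of_pos_right (mul_lt_of_lt_one_right (by positivity) hp) hr
  obtain ⟨δ, hδ, -, hsmall⟩ := exists_forall_mul_rpow_le (one_div_pos.2 hr)
    (2 * K * ProbabilityTheory.beta (1 - (N / 2 * p / r + γ / 2)) (1 - γ / 2))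
    (ε := 1 / (2 * r)) (by positivity)
  obtain ⟨T, hT, -, hdecay⟩ := exists_heatDecayOn_of_le_const_add hN (E := δ / 4)
    (φ := fun x => shiftedNegPowF f r ξ (u₀ x)) (fun ε hε => by
      obtain ⟨M, ψ, hψ, hmass, hle⟩ := hcl.exists_le_const_add hε
      refine ⟨(negPowF f r ξ).toNNReal + M, ψ, hψ, hmass, fun x => ?_⟩
      rw [ENNReal.coe_add, add_assoc]
      exact add_le_add_right (hle x) _) (by positivity)
  refine hw.hasBoundedLocalSolution hf hr hγ hK hsing (by linarith) hu₀
    (ulMass_shiftedNegPowF_lt_top f r ξ hcl.1.2) (by positivity) hdecay hT fun t _ => ?_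
  rw [hexp, sub_self, Real.rpow_zero, mul_one, barrierConst]
  convert hsmall (2 * (δ / 4)) ⟨by positivity, by linarith⟩ using 1
  ring

end GrowthWindow

lemma ClassS.exists_growthWindow (hf : ClassS q f) (hq : 1 ≤ q) (hr : 0 < r)
    (h : q < 1 + r ∨ q = 1 + r ∧ ∀ᶠ ξ in atTop, derivMulF f ξ ≤ q) :
    ∃ p ξ, (q < 1 + r → p < 1) ∧ GrowthWindow f r p ξ := by
  rcases h with hlt | ⟨heq, hle⟩
  · obtain ⟨p, ξ, hp, hw⟩ := hf.exists_growthWindow_of_lt hq hr hlt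
    exact ⟨p, ξ, fun _ => hp, hw⟩
  · obtain ⟨ξ, hw⟩ := hf.exists_growthWindow_one hr heq hle
    exact ⟨1, ξ, fun hlt => absurd heq hlt.ne, hw⟩

end Existence

end HardyParabolic

open HardyParabolic in
theorem mainTheorem1 (N : ℕ) (hN : 1 ≤ N) (q : ℝ) (hq : 1 ≤ q) (f : ℝ → ℝ)
    (hf : HardyParabolic.ClassS q f) (u₀ : EuclideanSpace ℝ (Fin N) → ℝ)
    (hu₀ : ∀ x, 0 ≤ u₀ x) (r : ℝ) :
    ∃ C : ℝ≥0, 0 < C ∧ ∀ γ : ℝ, 0 < γ → γ < min 2 (N : ℝ) →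
      ((N : ℝ) / (2 - γ) < r ∧ q < 1 + r ∧
          HardyParabolic.MemUL (fun x => HardyParabolic.negPowF f r (u₀ x))) ∨
        ((N : ℝ) / (2 - γ) < r ∧ q = 1 + r ∧
          HardyParabolic.MemUL (fun x => HardyParabolic.negPowF f r (u₀ x)) ∧
          ∀ᶠ ξ in atTop, HardyParabolic.derivMulF f ξ ≤ q) ∨
        (r = (N : ℝ) / (2 - γ) ∧ q < 1 + r ∧
          HardyParabolic.MemULClosure (fun x => HardyParabolic.negPowF f r (u₀ x))) →
      ∃ T : ℝ, 0 < T ∧ ∃ u : ℝ → EuclideanSpace ℝ (Fin N) → ℝ,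
        HardyParabolic.IsLocalSolution γ f u₀ T u ∧
        ∀ t ∈ Ioo 0 T,
          HardyParabolic.MemUL (fun x => HardyParabolic.negPowF f r (u t x)) ∧
          HardyParabolic.ulNorm (fun x => HardyParabolic.negPowF f r (u t x)) ≤ C := by
  have hNγ : ∀ γ : ℝ, γ < min 2 (N : ℝ) → 0 < (N : ℝ) / (2 - γ) := fun γ hγ =>
    div_pos (by positivity) (sub_pos.2 (hγ.trans_le (min_le_left _ _)))
  by_cases hcond : 0 < r ∧ MemUL (fun x => negPowF f r (u₀ x)) ∧
      (q < 1 + r ∨ q = 1 + r ∧ ∀ᶠ ξ in atTop, derivMulF f ξ ≤ q)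
  · obtain ⟨hr, hul, hqr⟩ := hcond
    obtain ⟨p, ξ, hp, hw⟩ := hf.exists_growthWindow hq hr hqr
    have hu₀m := hf.aemeasurable_of_negPowF hr hu₀ hul.1.aemeasurable
    have hmass := ulMass_shiftedNegPowF_lt_top f r ξ hul.2
    have hC : 2 * ulMass (fun x => shiftedNegPowF f r ξ (u₀ x)) < ∞ :=
      ENNReal.mul_lt_top ENNReal.ofNat_lt_top hmass
    refine ⟨(2 * ulMass fun x => shiftedNegPowF f r ξ (u₀ x)).toNNReal + 1, by positivity,
      fun γ hγ hγ' h => HasBoundedLocalSolution.mono ?_ ((ENNReal.coe_toNNReal hC.ne).ge.trans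
        (ENNReal.coe_le_coe.2 le_self_add))⟩
    rcases h with ⟨hγr, -⟩ | ⟨hγr, -⟩ | ⟨hγr, hlt, hcl⟩
    · exact hw.hasBoundedLocalSolution_of_lt hf hN hr hγ.le hγ' hγr hu₀m hmass
    · exact hw.hasBoundedLocalSolution_of_lt hf hN hr hγ.le hγ' hγr hu₀m hmass
    · exact hw.hasBoundedLocalSolution_of_eq hf hN hr hγ.le hγ' hγr (hp hlt) hu₀m hcl
  · refine ⟨1, one_pos, fun γ _ hγ' h => absurd ?_ hcond⟩
    rcases h with ⟨hγr, hlt, hul⟩ | ⟨hγr, heq, hul, hle⟩ | ⟨hγr, hlt, hcl⟩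
    · exact ⟨(hNγ γ hγ').trans hγr, hul, .inl hlt⟩
    · exact ⟨(hNγ γ hγ').trans hγr, hul, .inr ⟨heq, hle⟩⟩
    · exact ⟨hγr ▸ hNγ γ hγ', hcl.1, .inl hlt⟩
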